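/- Let $G$ be a group with identity $e$ and let $P\subseteq G$ be a submonoid such that $(G,P)$ is quasi-lattice ordered: $P\cap P^{-1}=\{e\}$ and, for the partial order $x\le y\iff x^{-1}y\in P$ on $G$, every nonempty finite subset of $G$ that has an upper bound has a least upper bound. Let $\{\varepsilon_x:x\in P\}$ be the standard orthonormal basis of $\ell^2(P)$, let $L_p$ $(p\in P)$ be the isometry $L_p\varepsilon_x=\varepsilon_{px}$, and let $C^*_\lambda(P)\subseteq\mathcal B(\ell^2(P))$ be the $C^*$-algebra generated by $\{L_p:p\in P\}$. Let $N:P\to[1,\infty)$ be multiplicative with $N(p)=1$ only for $p=e$. Let $U_t\varepsilon_x=N(x)^{it}\varepsilon_x$ and let $\alpha^N_t(a)=U_taU_t^*$, so $\alpha^N_t(L_p)=N(p)^{it}L_p$, be the associated dynamics on $C^*_\lambda(P)$. For $\beta\ge 0$ let $e^{-\beta H}$ be the diagonal operator $\varepsilon_x\mapsto N(x)^{-\beta}\varepsilon_x$, and put $$\beta_c=\inf\{\beta\in(0,\infty):\operatorname{Tr}(e^{-\beta H})<\infty\}\in[0,\infty],\qquad \operatorname{Tr}(e^{-\beta H})=\sum_{p\in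 P}N(p)^{-\beta},$$ with $\inf\emptyset=\infty$. An element $a$ is analytic for a dynamics $\alpha$ if $t\mapsto\alpha_t(a)$ extends to an entire function $z\mapsto\alpha_z(a)$. For $\beta>0$, a state $\varphi$ is KMS$_\beta$ if $\varphi(ab)=\varphi(b\,\alpha_{i\beta}(a))$ for all $a,b$ in some dense $\alpha$-invariant $*$-subalgebra of analytic elements; a state $\phi$ is KMS$_\infty$ if it is a weak* limit of KMS$_\beta$ states as $\beta\to\infty$; and a state $\phi$ is a ground state if $z\mapsto\phi(y\,\alpha_z(x))$ is bounded on the upper half plane for all $x,y$ with $x$ analytic. **Theorem.** Suppose $0<\beta_c<\infty$. 1. For each $\beta>\beta_c$ one has $\operatorname{Tr}(e^{-\beta H})<\infty$, the formula $\psi_\beta(X)=\operatorname{Tr}(Xe^{-\beta H})/\operatorname{Tr}(e^{-\beta H})$ defines a state on $\mathcal B(\ell^2(P))$, and the restriction of $\psi_\beta$ to $C^*_\lambda(P)$ is the unique KMS$_\beta$ state of $(C^*_\lambda(P),\alpha^N)$. The GNS representation $\pi$ of this restriction is faithful and of type I$_\infty$, that is, $\pi(C^*_\lambda(P))''$ is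 a factor of type I$_\infty$. 2. If $Q_e$ denotes the projection of $\ell^2(P)$ onto $\mathbb C\varepsilon_e$, then $\operatorname{Tr}(e^{-\beta H})\,\psi_\beta(Q_e)=1$ for every $\beta>\beta_c$. 3. There is a unique KMS$_{\beta_c}$ state of $(C^*_\lambda(P),\alpha^N)$. Moreover, for every value of $\beta_c\in[0,\infty]$, the Fock state $\phi_e(a)=\langle a\varepsilon_e,\varepsilon_e\rangle$ is the unique ground state of $(C^*_\lambda(P),\alpha^N)$; and if $\beta_c<\infty$, it is a KMS$_\infty$ state. -/

import Mathlib

open scoped ENNReal NNReal InnerProductSpace ComplexOrder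
open Filter Topology

noncomputable section

/-! ## Quasi-lattice ordered groups -/

/-- `(G, P)` is quasi-lattice ordered: `P ∩ P⁻¹ = {1}`, and for the order `x ≤ y ↔ x⁻¹ * y ∈ P`
on `G` every nonempty finite subset of `G` with an upper bound has a least upper bound in `G`. -/
structure IsQuasiLattice {G : Type*} [Group G] (P : Submonoid G) : Prop where
  eq_one_of_mem_inv_mem : ∀ x ∈ P, x⁻¹ ∈ P → x = 1
  exists_lub : ∀ F : Finset G, F.Nonempty →
    (∃ g : G, ∀ x ∈ F, x⁻¹ * g ∈ P) →
    ∃ s : G, (∀ x ∈ F, x⁻¹ * s ∈ P) ∧ ∀ g : G, (∀ x ∈ F, x⁻¹ * g ∈ P) → s⁻¹ * g ∈ P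

/-! ## C*-dynamical systems, KMS states and ground states -/

/-- A time evolution: a strongly continuous one-parameter group of `*`-automorphisms. -/
structure TimeEvolution (A : Type*) [CStarAlgebra A] where
  aut : ℝ → (A ≃⋆ₐ[ℂ] A)
  aut_zero : ∀ a, aut 0 a = a
  aut_add : ∀ s t a, aut (s + t) a = aut s (aut t a)
  continuous_aut : ∀ a, Continuous fun t => aut t a

section States

variable {A : Type*} [CStarAlgebra A]

/-- `F` is an entire extension `z ↦ α_z(a)` of `t ↦ α_t(a)` (there is at most one). -/
def IsEntireExtension (α : TimeEvolution A) (a : A) (F : ℂ → A) : Prop :=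
  Differentiable ℂ F ∧ ∀ t : ℝ, F t = α.aut t a

/-- `a` is analytic for `α`. -/
def IsAnalyticElement (α : TimeEvolution A) (a : A) : Prop :=
  ∃ F, IsEntireExtension α a F

variable [PartialOrder A] [StarOrderedRing A]

/-- A state: a positive linear functional taking the value `1` at the unit. -/
def IsState (φ : A →ₚ[ℂ] ℂ) : Prop := φ 1 = 1

/-- `φ` is a KMS state at inverse temperature `β`: it is a state with
`φ (a b) = φ (b α_{iβ}(a))` for all `a, b` in some dense `α`-invariant `*`-subalgebra of
analytic elements. For `β = 0` one requires in addition that `φ` be `α`-invariant. -/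
def IsKMS (α : TimeEvolution A) (β : ℝ) (φ : A →ₚ[ℂ] ℂ) : Prop :=
  IsState φ ∧
  (β = 0 → ∀ t a, φ (α.aut t a) = φ a) ∧
  ∃ D : NonUnitalStarSubalgebra ℂ A,
    Dense (D : Set A) ∧
    (∀ t, ∀ a ∈ D, α.aut t a ∈ D) ∧
    (∀ a ∈ D, IsAnalyticElement α a) ∧
    ∀ a ∈ D, ∀ b ∈ D, ∀ F, IsEntireExtension α a F →
      φ (a * b) = φ (b * F (Complex.I * β))

/-- `φ` is a ground state: it is a state, and for all `y` and all analytic `x` the entire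
function `z ↦ φ (y α_z(x))` is bounded on the upper half plane. -/
def IsGroundState (α : TimeEvolution A) (φ : A →ₚ[ℂ] ℂ) : Prop :=
  IsState φ ∧
  ∀ x y : A, ∀ F, IsEntireExtension α x F →
    ∃ C : ℝ, ∀ z : ℂ, 0 < z.im → ‖φ (y * F z)‖ ≤ C

/-- `φ` is a `KMS_∞` state: it is a state that is the weak* limit, as `β → ∞`, of `KMS_β`
states `ψ β`. -/
def IsKMSInfty (α : TimeEvolution A) (φ : A →ₚ[ℂ] ℂ) : Prop :=
  IsState φ ∧
  ∃ ψ : ℝ → (A →ₚ[ℂ] ℂ), (∀ᶠ β in atTop, IsKMS α β (ψ β)) ∧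
    ∀ a, Tendsto (fun β => ψ β a) atTop (𝓝 (φ a))

end States

/-! ## Type I_∞ representations -/

section VonNeumann

variable {H : Type*} [NormedAddCommGroup H] [InnerProductSpace ℂ H] [CompleteSpace H]

/-- The von Neumann algebra `π(A)''` generated by a representation `π`. -/
def generatedVN {A : Type*} [CStarAlgebra A] (π : A →⋆ₐ[ℂ] (H →L[ℂ] H)) :
    VonNeumannAlgebra H where
  toStarSubalgebra := StarSubalgebra.centralizer ℂ
    (StarSubalgebra.centralizer ℂ (Set.range π) : Set (H →L[ℂ] H))
  centralizer_centralizer' := by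
    change Set.centralizer (Set.centralizer
      (StarSubalgebra.centralizer ℂ
        (StarSubalgebra.centralizer ℂ (Set.range π) : Set (H →L[ℂ] H)) : Set (H →L[ℂ] H))) =
      (StarSubalgebra.centralizer ℂ
        (StarSubalgebra.centralizer ℂ (Set.range π) : Set (H →L[ℂ] H)) : Set (H →L[ℂ] H))
    simp only [StarSubalgebra.coe_centralizer_centralizer, Set.centralizer_centralizer_centralizer]

/-- `π(A)''` is indeed the double commutant of `π(A)`. -/
theorem coe_generatedVN {A : Type*} [CStarAlgebra A] (π : A →⋆ₐ[ℂ] (H →L[ℂ] H)) :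
    (generatedVN π : Set (H →L[ℂ] H)) = Set.centralizer (Set.centralizer (Set.range π)) := by
  have h : star (Set.range π) = Set.range π := by
    ext x
    constructor
    · rintro ⟨a, ha⟩
      exact ⟨star a, by rw [map_star, ha, star_star]⟩
    · rintro ⟨a, rfl⟩
      exact ⟨star a, map_star π a⟩
  change (StarSubalgebra.centralizer ℂ
    (StarSubalgebra.centralizer ℂ (Set.range π) : Set (H →L[ℂ] H)) : Set (H →L[ℂ] H)) = _
  rw [StarSubalgebra.coe_centralizer_centralizer, h, Set.union_self]

/-- A factor of type `I_∞`: a von Neumann algebra with trivial centre, which has a minimal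
projection `e` (a nonzero projection with `e M e = ℂ e`) and is infinite (its unit is equivalent
to a proper subprojection of itself). -/
structure IsTypeIInftyFactor (M : VonNeumannAlgebra H) : Prop where
  center_trivial : ∀ z ∈ M, (∀ x ∈ M, z * x = x * z) → ∃ c : ℂ, z = c • (1 : H →L[ℂ] H)
  exists_minimal : ∃ e ∈ M, IsStarProjection e ∧ e ≠ 0 ∧
    ∀ x ∈ M, ∃ c : ℂ, e * x * e = c • e
  infinite : ∃ v ∈ M, star v * v = 1 ∧ v * star v ≠ 1

end VonNeumann

/-! ## The reduced C*-algebra of a submonoid of a group -/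

section Toeplitz

variable {G : Type*} [Group G] (P : Submonoid G)

/-- The Hilbert space `ℓ²(P)`. -/
abbrev EllTwo : Type _ := lp (fun _ : P => ℂ) 2

variable {P}

/-- The standard basis vector `ε_x` of `ℓ²(P)`. -/
def stdVec (x : P) : EllTwo P := by
  classical exact lp.single 2 x (1 : ℂ)

theorem stdVec_apply (x y : P) [Decidable (y = x)] :
    (stdVec x : EllTwo P) y = if y = x then 1 else 0 := by
  classical
  rw [stdVec, lp.single_apply, Pi.single_apply]
  congr

theorem inner_stdVec_left (x : P) (f : EllTwo P) : ⟪stdVec x, f⟫_ℂ = f x := by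
  classical
  rw [stdVec, lp.inner_single_left]
  simp

theorem orthonormal_stdVec : Orthonormal ℂ (stdVec : P → EllTwo P) := by
  classical
  rw [orthonormal_iff_ite]
  intro x y
  rw [inner_stdVec_left, stdVec_apply]

theorem orthonormal_translate (p : P) : Orthonormal ℂ (fun x : P => stdVec (p * x)) :=
  orthonormal_stdVec.comp _ (mul_right_injective p)

/-- The left translation isometry `L_p` on `ℓ²(P)`, with `L_p ε_x = ε_{p x}`. -/
def leftTranslation (p : P) : EllTwo P →L[ℂ] EllTwo P :=
  (orthonormal_translate p).orthogonalFamily.linearIsometry.toContinuousLinearMap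

theorem leftTranslation_stdVec (p x : P) :
    leftTranslation p (stdVec x) = stdVec (p * x) := by
  classical
  simp [leftTranslation, stdVec]

variable (P)

/-- The reduced C*-algebra `C*_λ(P)`, the C*-subalgebra of `B(ℓ²(P))` generated by the `L_p`. -/
def reducedAlg : StarSubalgebra ℂ (EllTwo P →L[ℂ] EllTwo P) :=
  (StarAlgebra.adjoin ℂ (Set.range (leftTranslation (P := P)))).topologicalClosure

instance isClosed_reducedAlg : IsClosed (reducedAlg P : Set (EllTwo P →L[ℂ] EllTwo P)) :=
  StarSubalgebra.isClosed_topologicalClosure _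

/-- `C*_λ(P)`, with the order inherited from `B(ℓ²(P))`, is a star-ordered ring: its positive
elements are the elements `s* s` with `s ∈ C*_λ(P)`. -/
instance starOrderedRing_reducedAlg : StarOrderedRing (reducedAlg P) := by
  refine StarOrderedRing.of_nonneg_iff' (fun {x y} h z => ?_) (fun a => ⟨fun ha => ?_, ?_⟩)
  · exact add_le_add_right (α := EllTwo P →L[ℂ] EllTwo P) h z
  · have ha' : (0 : EllTwo P →L[ℂ] EllTwo P) ≤ a := ha
    have hsa : IsSelfAdjoint a := Subtype.ext (IsSelfAdjoint.of_nonneg ha').star_eq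
    have hsp : SpectrumRestricts a ContinuousMap.realToNNReal := by
      rw [SpectrumRestricts.nnreal_iff]
      intro x hx
      rw [← spectrum.preimage_algebraMap (R := ℝ) ℂ, Set.mem_preimage,
        StarSubalgebra.spectrum_eq] at hx
      rw [← Set.mem_preimage, spectrum.preimage_algebraMap] at hx
      exact spectrum_nonneg_of_nonneg ha' hx
    obtain ⟨s, hs, -, h⟩ :=
      CFC.exists_sqrt_of_isSelfAdjoint_of_quasispectrumRestricts hsa hsp
    exact ⟨s, by rw [hs.star_eq, h]⟩
  · rintro ⟨s, rfl⟩
    exact star_mul_self_nonneg (s : EllTwo P →L[ℂ] EllTwo P)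

variable {P}

/-- The restriction to `C*_λ(P)` of a positive functional on `B(ℓ²(P))`. -/
def restrictState (ψ : (EllTwo P →L[ℂ] EllTwo P) →ₚ[ℂ] ℂ) : reducedAlg P →ₚ[ℂ] ℂ :=
  PositiveLinearMap.mk₀ (ψ.toLinearMap ∘ₗ (reducedAlg P).subtype.toLinearMap)
    (fun a ha => ψ.map_nonneg (show (0 : EllTwo P →L[ℂ] EllTwo P) ≤ a from ha))

/-- The Fock state `a ↦ ⟨a ε_e, ε_e⟩` (Mathlib's inner product is linear in the second
variable). -/
def fockState : reducedAlg P →ₚ[ℂ] ℂ :=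
  PositiveLinearMap.mk₀
    { toFun := fun a => ⟪stdVec (1 : P), (a : EllTwo P →L[ℂ] EllTwo P) (stdVec 1)⟫_ℂ
      map_add' := fun a b => by simp
      map_smul' := fun c a => by simp }
    (fun a ha => by
      have h : (0 : EllTwo P →L[ℂ] EllTwo P) ≤ a := ha
      exact ((ContinuousLinearMap.nonneg_iff_isPositive _).1 h).inner_nonneg_right _)

/-! ## Diagonal operators, the trace, the dynamics and the critical inverse temperature -/

theorem memℓp_diag {c : P → ℂ} (hc : ∀ x, ‖c x‖ ≤ 1) (f : EllTwo P) :
    Memℓp (fun x => c x * f x) 2 :=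
  (lp.memℓp f).mono' fun x => by
    rw [norm_mul]
    exact mul_le_of_le_one_left (norm_nonneg _) (hc x)

/-- The diagonal operator `ε_x ↦ c x • ε_x` for a multiplier `c` with values in the unit disc. -/
def diagOp (c : P → ℂ) (hc : ∀ x, ‖c x‖ ≤ 1) : EllTwo P →L[ℂ] EllTwo P :=
  LinearMap.mkContinuous
    { toFun := fun f => ⟨fun x => c x * f x, memℓp_diag hc f⟩
      map_add' := fun f g => by
        ext x
        exact mul_add (c x) (f x) (g x)
      map_smul' := fun a f => by
        ext x
        exact mul_left_comm (c x) a (f x) } 1 (fun f => by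
      rw [one_mul]
      refine lp.norm_mono (by norm_num) fun x => ?_
      change ‖c x * f x‖ ≤ ‖f x‖
      rw [norm_mul]
      exact mul_le_of_le_one_left (norm_nonneg _) (hc x))

theorem diagOp_apply (c : P → ℂ) (hc : ∀ x, ‖c x‖ ≤ 1) (f : EllTwo P) (x : P) :
    diagOp c hc f x = c x * f x := rfl

theorem adjoint_diagOp (c : P → ℂ) (hc : ∀ x, ‖c x‖ ≤ 1) :
    star (diagOp c hc) = diagOp (fun x => star (c x)) (fun x => by simpa using hc x) := by
  rw [ContinuousLinearMap.star_eq_adjoint, eq_comm, ContinuousLinearMap.eq_adjoint_iff]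
  intro f g
  rw [lp.inner_eq_tsum, lp.inner_eq_tsum]
  refine tsum_congr fun x => ?_
  simp only [diagOp_apply, RCLike.inner_apply, map_mul, RCLike.star_def, RCLike.conj_conj]
  ring

/-- The eigenvalue `N(x)^{it}` of `U_t`. -/
def phase (N : P →* ℝ) (t : ℝ) (x : P) : ℂ := Complex.exp (Complex.I * t * Real.log (N x))

theorem norm_phase (N : P →* ℝ) (t : ℝ) (x : P) : ‖phase N t x‖ = 1 := by
  rw [phase, Complex.norm_exp]
  simp

theorem star_phase (N : P →* ℝ) (t : ℝ) (x : P) : star (phase N t x) = phase N (-t) x := by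
  simp [phase, ← Complex.exp_conj]

theorem phase_add (N : P →* ℝ) (s t : ℝ) (x : P) :
    phase N (s + t) x = phase N s x * phase N t x := by
  rw [phase, phase, phase, ← Complex.exp_add]
  push_cast
  ring_nf

theorem phase_zero (N : P →* ℝ) (x : P) : phase N 0 x = 1 := by simp [phase]

theorem phase_mul (N : P →* ℝ) (hN : ∀ p, 1 ≤ N p) (t : ℝ) (p x : P) :
    phase N t (p * x) = phase N t p * phase N t x := by
  have h (y : P) : N y ≠ 0 := (zero_lt_one.trans_le (hN y)).ne'
  rw [phase, phase, phase, ← Complex.exp_add, map_mul, Real.log_mul (h p) (h x)]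
  push_cast
  ring_nf

/-- The unitary `U_t ε_x = N(x)^{it} ε_x`. -/
def timeOp (N : P →* ℝ) (t : ℝ) : EllTwo P →L[ℂ] EllTwo P :=
  diagOp (phase N t) (fun x => (norm_phase N t x).le)

theorem star_timeOp (N : P →* ℝ) (t : ℝ) : star (timeOp N t) = timeOp N (-t) := by
  rw [timeOp, adjoint_diagOp]
  congr 1
  ext x
  exact star_phase N t x

theorem timeOp_add (N : P →* ℝ) (s t : ℝ) : timeOp N (s + t) = timeOp N s * timeOp N t := by
  ext f x
  change phase N (s + t) x * f x = phase N s x * (phase N t x * f x)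
  rw [phase_add, mul_assoc]

theorem timeOp_zero (N : P →* ℝ) : timeOp N 0 = 1 := by
  ext f x
  change phase N 0 x * f x = f x
  rw [phase_zero, one_mul]

/-- `U_t` as a unitary. -/
def timeUnitary (N : P →* ℝ) (t : ℝ) : unitary (EllTwo P →L[ℂ] EllTwo P) :=
  ⟨timeOp N t, by
    rw [Unitary.mem_iff, star_timeOp, ← timeOp_add, ← timeOp_add]
    simp [timeOp_zero]⟩

theorem timeOp_stdVec (N : P →* ℝ) (t : ℝ) (x : P) :
    timeOp N t (stdVec x) = phase N t x • stdVec x := by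
  classical
  ext y
  change phase N t y * (stdVec x : EllTwo P) y = phase N t x * (stdVec x : EllTwo P) y
  rw [stdVec_apply]
  split_ifs with h
  · rw [h]
  · simp

/-- Bounded operators on `ℓ²(P)` are determined by their values on the standard basis. -/
theorem ext_stdVec {S T : EllTwo P →L[ℂ] EllTwo P} (h : ∀ x, S (stdVec x) = T (stdVec x)) :
    S = T := by
  classical
  ext1 f
  have hf := lp.hasSum_single (p := 2) (by norm_num) f
  have hs (x : P) : lp.single 2 x (f x) = f x • (stdVec x : EllTwo P) := by
    rw [stdVec, ← lp.single_smul]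
    simp
  simp only [hs] at hf
  have h1 := hf.mapL S
  have h2 := hf.mapL T
  simp only [map_smul, h] at h1 h2
  exact h1.unique h2

theorem timeOp_conj_leftTranslation (N : P →* ℝ) (hN : ∀ p, 1 ≤ N p) (t : ℝ) (p : P) :
    timeOp N t * leftTranslation p * star (timeOp N t) = phase N t p • leftTranslation p := by
  refine ext_stdVec fun x => ?_
  rw [star_timeOp]
  simp only [mul_apply_eq_comp, timeOp_stdVec, map_smul, leftTranslation_stdVec,
    smul_apply, smul_smul]
  congr 1
  rw [phase_mul N hN, mul_left_comm, ← phase_add]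
  simp [phase_zero]

theorem timeOp_conj_mem (N : P →* ℝ) (hN : ∀ p, 1 ≤ N p) (t : ℝ)
    {a : EllTwo P →L[ℂ] EllTwo P} (ha : a ∈ reducedAlg P) :
    timeOp N t * a * star (timeOp N t) ∈ reducedAlg P := by
  have hc : Continuous fun b : EllTwo P →L[ℂ] EllTwo P =>
      timeOp N t * b * star (timeOp N t) := by fun_prop
  have hle : reducedAlg P ≤ (reducedAlg P).comap
      (Unitary.conjStarAlgAut ℂ _ (timeUnitary N t) : _ →⋆ₐ[ℂ] _) := by
    refine StarSubalgebra.topologicalClosure_minimal ?_ ?_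
    · refine StarAlgebra.adjoin_le ?_
      rintro _ ⟨p, rfl⟩
      change timeOp N t * leftTranslation p * star (timeOp N t) ∈ reducedAlg P
      rw [timeOp_conj_leftTranslation N hN]
      exact (reducedAlg P).smul_mem (StarSubalgebra.le_topologicalClosure _
        (StarAlgebra.subset_adjoin ℂ _ ⟨p, rfl⟩)) _
    · exact (isClosed_reducedAlg P).preimage hc
  exact hle ha

/-- The automorphism `a ↦ U_t a U_t*` of `C*_λ(P)`. -/
def dynAut (N : P →* ℝ) (hN : ∀ p, 1 ≤ N p) (t : ℝ) : reducedAlg P ≃⋆ₐ[ℂ] reducedAlg P where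
  toFun a := ⟨timeOp N t * a * star (timeOp N t), timeOp_conj_mem N hN t a.2⟩
  invFun a := ⟨timeOp N (-t) * a * star (timeOp N (-t)), timeOp_conj_mem N hN (-t) a.2⟩
  left_inv a := by
    refine Subtype.ext ?_
    change timeOp N (-t) * (timeOp N t * a * star (timeOp N t)) * star (timeOp N (-t)) = a
    simp only [star_timeOp, neg_neg, mul_assoc]
    rw [← timeOp_add, ← mul_assoc, ← timeOp_add]
    simp [timeOp_zero]
  right_inv a := by
    refine Subtype.ext ?_
    change timeOp N t * (timeOp N (-t) * a * star (timeOp N (-t))) * star (timeOp N t) = a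
    simp only [star_timeOp, neg_neg, mul_assoc]
    rw [← timeOp_add, ← mul_assoc, ← timeOp_add]
    simp [timeOp_zero]
  map_mul' a b := Subtype.ext
    (map_mul (Unitary.conjStarAlgAut ℂ _ (timeUnitary N t)) (a : EllTwo P →L[ℂ] EllTwo P) b)
  map_add' a b := Subtype.ext
    (map_add (Unitary.conjStarAlgAut ℂ _ (timeUnitary N t)) (a : EllTwo P →L[ℂ] EllTwo P) b)
  map_star' a := Subtype.ext
    (map_star (Unitary.conjStarAlgAut ℂ _ (timeUnitary N t)) (a : EllTwo P →L[ℂ] EllTwo P))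
  map_smul' c a := Subtype.ext
    (map_smul (Unitary.conjStarAlgAut ℂ _ (timeUnitary N t)) c (a : EllTwo P →L[ℂ] EllTwo P))

theorem coe_dynAut (N : P →* ℝ) (hN : ∀ p, 1 ≤ N p) (t : ℝ) (a : reducedAlg P) :
    (dynAut N hN t a : EllTwo P →L[ℂ] EllTwo P) = timeOp N t * a * star (timeOp N t) := rfl

theorem continuous_conj_timeOp (N : P →* ℝ) (hN : ∀ p, 1 ≤ N p)
    {a : EllTwo P →L[ℂ] EllTwo P} (ha : a ∈ reducedAlg P) :
    Continuous fun t => timeOp N t * a * star (timeOp N t) := by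
  let Φ (t : ℝ) := Unitary.conjStarAlgAut ℂ (EllTwo P →L[ℂ] EllTwo P) (timeUnitary N t)
  have hΦ (t : ℝ) (b) : Φ t b = timeOp N t * b * star (timeOp N t) := rfl
  simp only [← hΦ]
  have hnorm (t : ℝ) (b) : ‖Φ t b‖ = ‖b‖ := StarAlgEquiv.norm_map (Φ t) b
  have hadj : ∀ b ∈ StarAlgebra.adjoin ℂ (Set.range (leftTranslation (P := P))),
      Continuous fun t => Φ t b := by
    intro b hb
    induction hb using StarAlgebra.adjoin_induction with
    | mem x hx =>
      obtain ⟨p, rfl⟩ := hx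
      simp only [hΦ, timeOp_conj_leftTranslation N hN]
      unfold phase
      fun_prop
    | algebraMap r => simpa only [AlgHomClass.commutes] using continuous_const
    | add x y _ _ hx hy =>
      simp only [map_add]
      exact hx.add hy
    | mul x y _ _ hx hy =>
      simp only [map_mul]
      exact hx.mul hy
    | star x _ hx => simpa only [map_star] using hx.star
  have hcl : a ∈ closure (StarAlgebra.adjoin ℂ (Set.range (leftTranslation (P := P))) :
      Set (EllTwo P →L[ℂ] EllTwo P)) := ha
  refine continuous_of_uniform_approx_of_continuous fun u hu => ?_
  obtain ⟨ε, hε, hεu⟩ := Metric.mem_uniformity_dist.1 hu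
  obtain ⟨b, hb, hab⟩ := Metric.mem_closure_iff.1 hcl ε hε
  refine ⟨fun t => Φ t b, hadj b hb, fun t => hεu ?_⟩
  rw [dist_eq_norm, ← map_sub, hnorm, ← dist_eq_norm]
  exact hab

/-- The dynamics `α^N` on `C*_λ(P)`, implemented by the unitaries `U_t`. -/
def dynamics (N : P →* ℝ) (hN : ∀ p, 1 ≤ N p) : TimeEvolution (reducedAlg P) where
  aut := dynAut N hN
  aut_zero a := Subtype.ext (by simp [coe_dynAut, timeOp_zero])
  aut_add s t a := Subtype.ext (by simp [coe_dynAut, timeOp_add, star_mul, mul_assoc])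
  continuous_aut a := Continuous.subtype_mk (continuous_conj_timeOp N hN a.2) _

/-- `exp(-βH)`, the diagonal operator `ε_x ↦ N(x)^{-β} ε_x`. -/
def expNegH (N : P →* ℝ) (hN : ∀ p, 1 ≤ N p) (β : ℝ≥0) : EllTwo P →L[ℂ] EllTwo P :=
  diagOp (fun x => ((N x ^ (-(β : ℝ)) : ℝ) : ℂ)) (fun x => by
    have h : 0 ≤ N x := zero_le_one.trans (hN x)
    rw [Complex.norm_real, Real.norm_of_nonneg (Real.rpow_nonneg h _)]
    exact Real.rpow_le_one_of_one_le_of_nonpos (hN x) (by simp))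

theorem expNegH_apply (N : P →* ℝ) (hN : ∀ p, 1 ≤ N p) (β : ℝ≥0) (f : EllTwo P) (x : P) :
    expNegH N hN β f x = ((N x ^ (-(β : ℝ)) : ℝ) : ℂ) * f x := rfl

/-- The trace `Tr T = ∑ₓ ⟨T ε_x, ε_x⟩`, for trace class `T`. -/
def opTrace (T : EllTwo P →L[ℂ] EllTwo P) : ℂ := ∑' x : P, ⟪stdVec x, T (stdVec x)⟫_ℂ

/-- The trace of a positive operator, as an element of `[0, ∞]`. -/
def posTrace (T : EllTwo P →L[ℂ] EllTwo P) : ℝ≥0∞ :=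
  ∑' x : P, ENNReal.ofReal (⟪stdVec x, T (stdVec x)⟫_ℂ).re

theorem posTrace_expNegH (N : P →* ℝ) (hN : ∀ p, 1 ≤ N p) (β : ℝ≥0) :
    posTrace (expNegH N hN β) = ∑' x : P, ENNReal.ofReal (N x ^ (-(β : ℝ))) := by
  classical
  refine tsum_congr fun x => ?_
  rw [inner_stdVec_left, expNegH_apply, stdVec_apply, if_pos rfl, mul_one, Complex.ofReal_re]

/-- The critical inverse temperature
`β_c = inf {β ∈ (0, ∞) : Tr(exp(-βH)) < ∞} ∈ [0, ∞]`, with `inf ∅ = ∞`. -/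
def betaCrit (N : P →* ℝ) (hN : ∀ p, 1 ≤ N p) : ℝ≥0∞ :=
  sInf ((fun β : ℝ≥0 => (β : ℝ≥0∞)) '' {β | 0 < β ∧ posTrace (expNegH N hN β) < ∞})

/-- The functional `X ↦ Tr(exp(-βH))⁻¹ Tr(X exp(-βH))` on `B(ℓ²(P))` defining the generalised
Gibbs state at inverse temperature `β > β_c`. -/
def gibbs (N : P →* ℝ) (hN : ∀ p, 1 ≤ N p) (β : ℝ≥0) (X : EllTwo P →L[ℂ] EllTwo P) : ℂ :=
  (opTrace (expNegH N hN β))⁻¹ * opTrace (X * expNegH N hN β)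

/-- The projection `Q_e` of `ℓ²(P)` onto the vacuum subspace `ℂ ε_e`. -/
def vacuumProj (P : Submonoid G) : EllTwo P →L[ℂ] EllTwo P :=
  (Submodule.span ℂ {(stdVec 1 : EllTwo P)}).starProjection

end Toeplitz

end

noncomputable section

/-! ### Nica covariance and the dense span of the words L_p L_q* -/

section Algebra

variable {G : Type*} [Group G] {P : Submonoid G}

/-! Everything rests on Nica covariance: L_p* L_q is 0 if p and q have no common right multiple, and
is L_{p'} L_{q'}* if p p' = q q' is the least one. Hence the words L_p L_q* span a dense subspace,
and a positive functional is determined by its values on them.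

KMS states. For β > 0 a state φ is KMS exactly when φ(L_p b) = N(p)^{-β} φ(b L_p) for all p and b.
The definition only supplies the condition on some dense subalgebra, which need not contain L_p; a
three lines argument bridges this (`IsKMS.map_eigenvector_mul`). The relation forces φ(L_p L_p*) =
N(p)^{-β}. If N(p) ≠ N(q), moving both letters once around gives φ(L_p L_q*) = 0. If p ≠ q but N(p)
= N(q), moving L_p around yields another word of this kind and a factor at most c^{-β} < 1, where c
> 1 bounds N below off the identity; iterating gives 0 again (`apply_gen_mul_star_gen_of_ne`). Such
a c exists because a finite trace makes the sets {N ≤ C} finite. Existence above β_c is a reindexing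
of the trace; at β_c it follows by weak* compactness.

Ground states. For q ≠ 1, α_z(L_q*) grows exponentially up the imaginary axis, so a ground state
kills every y L_q*, and by adjoints every L_p with p ≠ 1. Only the Fock state is left. It is a
ground state because α_z(x)ε_e has coordinates N(p)^{iz} times those of xε_e, and it is the limit of
the Gibbs states by dominated convergence.

Type. The Gibbs state is faithful since all its weights are positive. In its GNS representation π
let S be the space of vectors killed by all π(L_p*), p ≠ 1. The commutant preserves S and every word
compresses to a scalar on S, so the projection onto S is minimal in π(A)''. The cyclic vector is an
orthogonal sum of vectors π(L_p)ω_p with ω_p in S, because their squared norms N(p)^{-β}/Tr(e^{-βH})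
add up to 1 (`IsNicaFamily.exists_hasSum_vacuum`). Hence π(A)S is total and the centre is scalar,
while π(L_q), q ≠ 1, is a proper isometry. -/

theorem star_leftTranslation_apply (p : P) (f : EllTwo P) (x : P) :
    star (leftTranslation p) f x = f (p * x) := by
  rw [← inner_stdVec_left, ContinuousLinearMap.star_eq_adjoint,
    ContinuousLinearMap.adjoint_inner_right, leftTranslation_stdVec, inner_stdVec_left]

theorem star_leftTranslation_stdVec_mul (p x : P) :
    star (leftTranslation p) (stdVec (p * x)) = stdVec x := by
  classical
  ext y
  simp [star_leftTranslation_apply, stdVec_apply]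

theorem star_leftTranslation_stdVec_of_forall_ne {p y : P} (h : ∀ x, p * x ≠ y) :
    star (leftTranslation p) (stdVec y) = 0 := by
  classical
  ext x
  simp [star_leftTranslation_apply, stdVec_apply, h x]

theorem norm_stdVec (x : P) : ‖(stdVec x : EllTwo P)‖ = 1 := orthonormal_stdVec.1 x

/-- The generator `L_p` of `C*_λ(P)`. -/
def gen (p : P) : reducedAlg P :=
  ⟨leftTranslation p, StarSubalgebra.le_topologicalClosure _
    (StarAlgebra.subset_adjoin ℂ _ ⟨p, rfl⟩)⟩

theorem coe_gen (p : P) : (gen p : EllTwo P →L[ℂ] EllTwo P) = leftTranslation p := rfl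

theorem gen_one : gen (1 : P) = 1 :=
  Subtype.ext (ext_stdVec fun x => by simp [coe_gen, leftTranslation_stdVec])

theorem gen_mul (p q : P) : gen (p * q) = gen p * gen q :=
  Subtype.ext (ext_stdVec fun x => by simp [coe_gen, leftTranslation_stdVec, mul_assoc])

theorem star_gen_mul_gen (p : P) : star (gen p) * gen p = 1 :=
  Subtype.ext (ext_stdVec fun x => by
    simp [coe_gen, leftTranslation_stdVec, star_leftTranslation_stdVec_mul])

/-- The Nica covariance relation for a pair with least common right multiple `p p' = q q'`. -/
theorem star_gen_mul_gen_eq {p q p' q' : P} (h : p * p' = q * q')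
    (hlub : ∀ x y, p * x = q * y → ∃ r, x = p' * r) :
    star (gen p) * gen q = gen p' * star (gen q') := by
  classical
  refine Subtype.ext (ext_stdVec fun y => ?_)
  change star (leftTranslation p) (leftTranslation q (stdVec y)) =
    leftTranslation p' (star (leftTranslation q') (stdVec y))
  rw [leftTranslation_stdVec]
  by_cases hy : ∃ r, q' * r = y
  · obtain ⟨r, rfl⟩ := hy
    rw [star_leftTranslation_stdVec_mul, ← mul_assoc, ← h, mul_assoc,
      star_leftTranslation_stdVec_mul, leftTranslation_stdVec]
  · push Not at hy
    rw [star_leftTranslation_stdVec_of_forall_ne hy, map_zero]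
    refine star_leftTranslation_stdVec_of_forall_ne fun x hx => ?_
    obtain ⟨r, rfl⟩ := hlub x y hx
    rw [← mul_assoc, h, mul_assoc] at hx
    exact hy r (mul_left_cancel hx)

theorem star_gen_mul_gen_eq_zero {p q : P} (h : ∀ x y, p * x ≠ q * y) :
    star (gen p) * gen q = 0 :=
  Subtype.ext (ext_stdVec fun y => by
    change star (leftTranslation p) (leftTranslation q (stdVec y)) = 0
    rw [leftTranslation_stdVec]
    exact star_leftTranslation_stdVec_of_forall_ne fun x => h x y)

/-- A common right multiple is an upper bound of {p, q} in G, so a least upper bound s exists; the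
cofactors are p⁻¹s and q⁻¹s. -/
theorem IsQuasiLattice.exists_lcm (hP : IsQuasiLattice P) {p q : P}
    (h : ∃ x y, p * x = q * y) :
    ∃ p' q', p * p' = q * q' ∧ ∀ x y, p * x = q * y → ∃ r, x = p' * r := by
  classical
  obtain ⟨x, y, hxy⟩ := h
  have hub : ∀ {x y : P}, p * x = q * y → ∀ z ∈ ({(p : G), (q : G)} : Finset G),
      z⁻¹ * ((p : G) * x) ∈ P := by
    intro x y hxy z hz
    rw [Finset.mem_insert, Finset.mem_singleton] at hz
    rcases hz with rfl | rfl
    · simp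
    · have : (p : G) * x = q * y := congrArg Subtype.val hxy
      rw [this]
      simp
  obtain ⟨s, hs, hmin⟩ := hP.exists_lub {(p : G), (q : G)} (by simp) ⟨_, hub hxy⟩
  refine ⟨⟨(p : G)⁻¹ * s, hs _ (by simp)⟩, ⟨(q : G)⁻¹ * s, hs _ (by simp)⟩,
    Subtype.ext (by simp), fun x y hxy => ⟨⟨_, hmin _ (hub hxy)⟩, Subtype.ext ?_⟩⟩
  simp

theorem IsQuasiLattice.star_gen_mul_gen (hP : IsQuasiLattice P) (p q : P) :
    star (gen p) * gen q = 0 ∨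
    ∃ p' q', p * p' = q * q' ∧ star (gen p) * gen q = gen p' * star (gen q') := by
  by_cases h : ∃ x y, p * x = q * y
  · obtain ⟨p', q', h1, h2⟩ := hP.exists_lcm h
    exact Or.inr ⟨p', q', h1, star_gen_mul_gen_eq h1 h2⟩
  · push Not at h
    exact Or.inl (star_gen_mul_gen_eq_zero h)

variable (P) in
/-- The dense `*`-subalgebra of `C*_λ(P)` generated by the `L_p`. -/
def polyAlg : StarSubalgebra ℂ (reducedAlg P) := StarAlgebra.adjoin ℂ (Set.range gen)

variable (P) in
theorem dense_polyAlg : Dense (polyAlg P : Set (reducedAlg P)) := by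
  have himg : (polyAlg P).map (reducedAlg P).subtype =
      StarAlgebra.adjoin ℂ (Set.range (leftTranslation (P := P))) := by
    rw [polyAlg, StarAlgHom.map_adjoin, ← Set.range_comp]
    rfl
  have himg' : (Subtype.val '' (polyAlg P : Set (reducedAlg P)) :
      Set (EllTwo P →L[ℂ] EllTwo P)) =
      (StarAlgebra.adjoin ℂ (Set.range (leftTranslation (P := P))) : Set _) := by
    rw [← himg]
    rfl
  rw [Subtype.dense_iff]
  exact fun a ha => closure_mono himg'.ge ha

/-- Induction principle for the elements of `polyAlg P`. -/
theorem polyAlg_induction {p : reducedAlg P → Prop} (hgen : ∀ q, p (gen q))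
    (hstar : ∀ q, p (star (gen q))) (hsmul : ∀ r : ℂ, p (r • 1))
    (hadd : ∀ x y, p x → p y → p (x + y)) (hmul : ∀ x y, p x → p y → p (x * y))
    {a : reducedAlg P} (ha : a ∈ polyAlg P) : p a := by
  have ha' : a ∈ Algebra.adjoin ℂ (Set.range (gen (P := P)) ∪ star (Set.range gen)) := ha
  induction ha' using Algebra.adjoin_induction with
  | mem x hx =>
    rcases hx with ⟨q, rfl⟩ | ⟨q, hq⟩
    · exact hgen q
    · rw [← star_star x, ← hq]
      exact hstar q
  | algebraMap r => rw [Algebra.algebraMap_eq_smul_one]; exact hsmul r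
  | add x y hx hy h1 h2 => exact hadd x y (h1 hx) (h2 hy)
  | mul x y hx hy h1 h2 => exact hmul x y (h1 hx) (h2 hy)

variable (P) in
/-- The linear span of the elements `L_p L_q*`. -/
def wordSpan : Submodule ℂ (reducedAlg P) :=
  Submodule.span ℂ (Set.range fun x : P × P => gen x.1 * star (gen x.2))

theorem gen_mul_star_gen_mem_wordSpan (p q : P) : gen p * star (gen q) ∈ wordSpan P :=
  Submodule.subset_span ⟨(p, q), rfl⟩

/-- In a product of two words, Nica covariance rewrites the inner factor L_q* L_r, leaving 0 or a
single word. -/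
theorem IsQuasiLattice.mul_mem_wordSpan (hP : IsQuasiLattice P) {a b : reducedAlg P}
    (ha : a ∈ wordSpan P) (hb : b ∈ wordSpan P) : a * b ∈ wordSpan P := by
  have hle : wordSpan P * wordSpan P ≤ wordSpan P := by
    rw [wordSpan, Submodule.span_mul_span, Submodule.span_le]
    rintro _ ⟨_, ⟨⟨p, q⟩, rfl⟩, _, ⟨⟨r, s⟩, rfl⟩, rfl⟩
    change gen p * star (gen q) * (gen r * star (gen s)) ∈ wordSpan P
    rw [show gen p * star (gen q) * (gen r * star (gen s)) =
      gen p * (star (gen q) * gen r) * star (gen s) by noncomm_ring]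
    rcases hP.star_gen_mul_gen q r with h | ⟨q', r', -, h⟩
    · rw [h]
      simp
    · rw [h, show gen p * (gen q' * star (gen r')) * star (gen s) =
        gen (p * q') * star (gen (s * r')) by simp only [gen_mul, star_mul]; noncomm_ring]
      exact gen_mul_star_gen_mem_wordSpan _ _
  exact hle (Submodule.mul_mem_mul ha hb)

theorem IsQuasiLattice.dense_wordSpan (hP : IsQuasiLattice P) :
    Dense (wordSpan P : Set (reducedAlg P)) := by
  refine (dense_polyAlg P).mono fun a ha => ?_
  refine polyAlg_induction (p := fun a => a ∈ wordSpan P) (fun q => ?_) (fun q => ?_)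
    (fun r => ?_) (fun x y => add_mem) (fun x y => hP.mul_mem_wordSpan) ha
  · simpa [gen_one] using gen_mul_star_gen_mem_wordSpan q 1
  · simpa [gen_one] using gen_mul_star_gen_mem_wordSpan 1 q
  · simpa [gen_one] using (wordSpan P).smul_mem r (gen_mul_star_gen_mem_wordSpan 1 1)

/-- A closed linear condition on `C*_λ(P)` may be checked on the elements `L_p L_q*`. -/
theorem IsQuasiLattice.mem_of_isClosed (hP : IsQuasiLattice P) (S : Submodule ℂ (reducedAlg P))
    (hS : IsClosed (S : Set (reducedAlg P))) (h : ∀ p q, gen p * star (gen q) ∈ S)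
    (a : reducedAlg P) : a ∈ S := by
  have hle : wordSpan P ≤ S := Submodule.span_le.2 (by rintro _ ⟨x, rfl⟩; exact h _ _)
  exact hS.closure_subset_iff.2 hle (hP.dense_wordSpan a)

theorem IsQuasiLattice.positiveLinearMap_ext (hP : IsQuasiLattice P) {φ ψ : reducedAlg P →ₚ[ℂ] ℂ}
    (h : ∀ p q, φ (gen p * star (gen q)) = ψ (gen p * star (gen q))) : φ = ψ := by
  ext a
  exact hP.mem_of_isClosed (LinearMap.eqLocus φ.toLinearMap ψ.toLinearMap)
    (isClosed_eq (map_continuous φ) (map_continuous ψ)) h a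

end Algebra

/-! ### Entire extensions of orbits of the dynamics -/

section EntireExtensions

/-- Identity theorem: the real points 1/(n+1) accumulate at 0. -/
theorem Differentiable.eq_of_eqOn_real {E : Type*} [NormedAddCommGroup E] [NormedSpace ℂ E]
    [CompleteSpace E] {f g : ℂ → E} (hf : Differentiable ℂ f) (hg : Differentiable ℂ g)
    (h : ∀ t : ℝ, f t = g t) : f = g := by
  refine AnalyticOnNhd.eq_of_frequently_eq (z₀ := 0)
    (hf.differentiableOn.analyticOnNhd isOpen_univ)
    (hg.differentiableOn.analyticOnNhd isOpen_univ) ?_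
  have ht : Tendsto (fun n : ℕ => (((1 / ((n : ℝ) + 1) : ℝ)) : ℂ)) atTop (𝓝[≠] 0) := by
    refine tendsto_nhdsWithin_iff.2 ⟨?_, Eventually.of_forall fun n => ?_⟩
    · have := (Complex.continuous_ofReal.tendsto 0).comp
        (tendsto_one_div_add_atTop_nhds_zero_nat (𝕜 := ℝ))
      simpa [Function.comp_def] using this
    · have : (1 / ((n : ℝ) + 1) : ℝ) ≠ 0 := by positivity
      exact Complex.ofReal_ne_zero.2 this
  exact ht.frequently (Frequently.of_forall fun n => h _)

variable {A : Type*} [CStarAlgebra A] {α : TimeEvolution A}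

theorem TimeEvolution.norm_aut (α : TimeEvolution A) (t : ℝ) (a : A) : ‖α.aut t a‖ = ‖a‖ :=
  StarAlgEquiv.norm_map (α.aut t) a

/-- The automorphism `α_t` as a continuous linear map. -/
def TimeEvolution.autL (α : TimeEvolution A) (t : ℝ) : A →L[ℂ] A :=
  LinearMap.mkContinuous
    { toFun := α.aut t
      map_add' := map_add _
      map_smul' := map_smul _ } 1 fun a => by
        rw [one_mul]
        exact (α.norm_aut t a).le

theorem IsEntireExtension.unique {a : A} {F F' : ℂ → A} (h : IsEntireExtension α a F)
    (h' : IsEntireExtension α a F') : F = F' :=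
  h.1.eq_of_eqOn_real h'.1 fun t => (h.2 t).trans (h'.2 t).symm

theorem IsEntireExtension.shift {a : A} {F : ℂ → A} (h : IsEntireExtension α a F) (t : ℝ) :
    IsEntireExtension α (α.aut t a) (fun z => F (z + t)) := by
  refine ⟨h.1.comp (differentiable_id.add_const _), fun s => ?_⟩
  rw [← α.aut_add, ← h.2, Complex.ofReal_add]

theorem IsEntireExtension.apply_add {a : A} {F : ℂ → A} (h : IsEntireExtension α a F) (z : ℂ)
    (t : ℝ) : F (z + t) = α.aut t (F z) := by
  refine congrFun (Differentiable.eq_of_eqOn_real (f := fun z => F (z + t))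
    (g := fun z => α.autL t (F z)) (h.shift t).1 ((α.autL t).differentiable.comp h.1)
    fun s => ?_) z
  refine ((h.shift t).2 s).trans ?_
  rw [h.2, ← α.aut_add, add_comm, α.aut_add]
  rfl

/-- Real translations act by isometric automorphisms, so the norm depends only on the imaginary
part. This makes extensions bounded on strips, as the three lines theorem requires. -/
theorem IsEntireExtension.norm_apply {a : A} {F : ℂ → A} (h : IsEntireExtension α a F) (z : ℂ) :
    ‖F z‖ = ‖F (Complex.I * z.im)‖ := by
  conv_lhs => rw [← Complex.re_add_im z, add_comm, mul_comm, h.apply_add, α.norm_aut]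

theorem IsEntireExtension.add {a b : A} {F F' : ℂ → A} (h : IsEntireExtension α a F)
    (h' : IsEntireExtension α b F') : IsEntireExtension α (a + b) (fun z => F z + F' z) :=
  ⟨h.1.add h'.1, fun t => by rw [map_add, ← h.2, ← h'.2]⟩

theorem IsEntireExtension.mul {a b : A} {F F' : ℂ → A} (h : IsEntireExtension α a F)
    (h' : IsEntireExtension α b F') : IsEntireExtension α (a * b) (fun z => F z * F' z) :=
  ⟨h.1.mul h'.1, fun t => by rw [map_mul, ← h.2, ← h'.2]⟩

theorem isEntireExtension_of_eigenvector {a : A} {l : ℝ}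
    (ha : ∀ t : ℝ, α.aut t a = Complex.exp (Complex.I * t * l) • a) :
    IsEntireExtension α a (fun z => Complex.exp (Complex.I * z * l) • a) :=
  ⟨by fun_prop, fun t => (ha t).symm⟩

theorem TimeEvolution.aut_smul_one (α : TimeEvolution A) (t : ℝ) (r : ℂ) :
    α.aut t (r • 1) = r • 1 := by
  rw [map_smul, map_one]

theorem isEntireExtension_smul_one (r : ℂ) : IsEntireExtension α (r • 1) (fun _ => r • 1) :=
  ⟨differentiable_const _, fun t => (α.aut_smul_one t r).symm⟩

end EntireExtensions

/-! ### The three lines theorem at the midpoint of a strip -/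

section ThreeLines

open Complex.HadamardThreeLines

theorem norm_le_sqrt_mul_sqrt_of_strip {f : ℂ → ℂ} {g : ℝ → ℝ} {β a b : ℝ} (hβ : 0 < β)
    (hf : Differentiable ℂ f) (hg : Continuous g) (hfg : ∀ z, ‖f z‖ ≤ g z.re)
    (ha : ∀ s : ℝ, ‖f (Complex.I * s)‖ ≤ a) (hb : ∀ s : ℝ, ‖f (β + Complex.I * s)‖ ≤ b) :
    ‖f (β / 2 : ℝ)‖ ≤ √a * √b := by
  have hre (z : ℂ) : z = z.re + Complex.I * z.im := by
    rw [mul_comm, Complex.re_add_im]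
  have h := norm_le_interp_of_mem_verticalClosedStrip' (f := f) (z := (β / 2 : ℝ)) (a := a)
    (b := b) hβ ?_ hf.diffContOnCl ?_ ?_ ?_
  · rw [Real.sqrt_eq_rpow, Real.sqrt_eq_rpow]
    have h1 : (((β / 2 : ℝ) : ℂ).re - 0) / (β - 0) = 1 / 2 := by
      rw [Complex.ofReal_re, sub_zero, sub_zero]
      field_simp
    rwa [h1, show (1 - 1 / 2 : ℝ) = 1 / 2 by norm_num] at h
  · simp only [verticalClosedStrip, Set.mem_preimage, Complex.ofReal_re]
    constructor <;> linarith
  · obtain ⟨C, hC⟩ := isCompact_Icc.bddAbove_image (f := g) (K := Set.Icc 0 β) hg.continuousOn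
    refine ⟨C, ?_⟩
    rintro _ ⟨z, hz, rfl⟩
    exact (hfg z).trans (hC ⟨z.re, hz, rfl⟩)
  · intro z hz
    rw [hre z, show z.re = 0 from hz]
    simpa using ha z.im
  · intro z hz
    rw [hre z, show z.re = β from hz]
    exact hb z.im

end ThreeLines

/-! ### The KMS condition for eigenvectors of the dynamics -/

section EigenKMS

variable {A : Type*} [CStarAlgebra A] [PartialOrder A] [StarOrderedRing A] {α : TimeEvolution A}

/-- The distance of the two sides of the KMS condition for an eigenvector `a` of the dynamics,
estimated by approximating `a` by an element `a'` for which the condition holds. -/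
theorem norm_kms_defect_le {β l : ℝ} (hβ : 0 < β) {φ : A →ₚ[ℂ] ℂ} {C : ℝ≥0}
    (hC : ∀ x, ‖φ x‖ ≤ C * ‖x‖) {a a' b : A} {F : ℂ → A}
    (ha : ∀ t : ℝ, α.aut t a = Complex.exp (Complex.I * t * l) • a)
    (hF : IsEntireExtension α a' F)
    (hkms : ∀ t : ℝ, φ (α.aut t a' * b) = φ (b * F (Complex.I * β + t))) :
    ‖Complex.exp (-(β / 2 * l)) * φ (b * a) - Complex.exp (β / 2 * l) * φ (a * b)‖ ≤
      √(C * (‖b‖ * ‖a' - a‖)) *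
        √(C * (‖a'‖ * ‖b‖) + Real.exp (-(β * l)) * (C * (‖b‖ * ‖a‖))) +
      √(C * (‖b‖ * ‖a'‖) + Real.exp (β * l) * (C * (‖a‖ * ‖b‖))) *
        √(C * (‖a' - a‖ * ‖b‖)) := by
  have hmul (x y : A) : ‖φ (x * y)‖ ≤ C * (‖x‖ * ‖y‖) :=
    (hC _).trans (mul_le_mul_of_nonneg_left (norm_mul_le x y) C.2)
  have hexp (w : ℂ) : ‖Complex.exp (-(w * l))‖ = Real.exp (-(w.re * l)) := by
    rw [Complex.norm_exp]
    simp
  have haut (s : ℝ) : α.aut s (a' - a) = α.aut s a' - Complex.exp (Complex.I * s * l) • a := by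
    rw [map_sub, ha]
  -- Rotating by I turns the strip 0 ≤ Im ≤ β into 0 ≤ Re ≤ β. The left edge carries values φ(b
  -- α_s(a')) and, by the KMS condition, the right edge carries values φ(α_s(a') b).
  let h : ℂ → ℂ := fun w => φ (b * F (Complex.I * w))
  have hφd {K : ℂ → A} (hK : Differentiable ℂ K) : Differentiable ℂ fun w => φ (K w) :=
    (ContinuousLinearMap.differentiable (⟨φ.toLinearMap, map_continuous φ⟩ : A →L[ℂ] ℂ)).comp hK
  have hFI : Differentiable ℂ fun w : ℂ => F (Complex.I * w) :=
    hF.1.comp (differentiable_id.const_mul _)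
  have hd : Differentiable ℂ h := hφd ((differentiable_const b).mul hFI)
  have hh0 (s : ℝ) : h (Complex.I * s) = φ (b * α.aut (-s) a') := by
    change φ (b * F (Complex.I * (Complex.I * s))) = _
    rw [← mul_assoc, Complex.I_mul_I, ← hF.2]
    simp
  have hh1 (s : ℝ) : h (β + Complex.I * s) = φ (α.aut (-s) a' * b) := by
    change φ (b * F (Complex.I * (β + Complex.I * s))) = _
    rw [hkms, mul_add, ← mul_assoc, Complex.I_mul_I]
    simp
  have hh (w : ℂ) : ‖h w‖ ≤ C * (‖b‖ * ‖F (Complex.I * w.re)‖) := by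
    refine (hmul _ _).trans_eq ?_
    rw [hF.norm_apply (Complex.I * w)]
    simp
  have hcont : Continuous fun x : ℝ => C * (‖b‖ * ‖F (Complex.I * x)‖) := by
    have := hF.1.continuous
    fun_prop
  -- For a' = a the function h would be exp(-wl) φ(ba). The difference is small on the left edge and
  -- merely bounded on the right edge; at the midpoint the geometric mean is still small.
  have e0 : ‖h (β / 2 : ℝ) - Complex.exp (-((β / 2 : ℝ) * l)) * φ (b * a)‖ ≤
      √(C * (‖b‖ * ‖a' - a‖)) *
        √(C * (‖a'‖ * ‖b‖) + Real.exp (-(β * l)) * (C * (‖b‖ * ‖a‖))) := by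
    refine norm_le_sqrt_mul_sqrt_of_strip
      (f := fun w => h w - Complex.exp (-(w * l)) * φ (b * a))
      (g := fun x => C * (‖b‖ * ‖F (Complex.I * x)‖) + Real.exp (-(x * l)) * (C * (‖b‖ * ‖a‖)))
      hβ (by fun_prop) (by fun_prop) (fun w => ?_) (fun s => ?_) (fun s => ?_)
    · refine (norm_sub_le _ _).trans (add_le_add (hh w) ?_)
      rw [norm_mul, hexp]
      gcongr
      exact hmul _ _
    · have : h (Complex.I * s) - Complex.exp (-(Complex.I * s * l)) * φ (b * a) =
          φ (b * α.aut (-s) (a' - a)) := by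
        rw [hh0, haut, mul_sub, map_sub, mul_smul_comm, map_smul, smul_eq_mul]
        simp
      rw [this]
      refine (hmul _ _).trans_eq ?_
      rw [α.norm_aut]
    · refine (norm_sub_le _ _).trans (add_le_add ?_ ?_)
      · rw [hh1]
        refine (hmul _ _).trans_eq ?_
        rw [α.norm_aut]
      · rw [norm_mul, hexp]
        simp only [Complex.add_re, Complex.ofReal_re, Complex.mul_re, Complex.I_re, zero_mul,
          Complex.I_im, Complex.ofReal_im, mul_zero, sub_zero, add_zero]
        gcongr
        exact hmul _ _
  -- The mirror estimate: exp(-(w - β)l) φ(ab) is close to h on the right edge. Comparing both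
  -- estimates at β/2 explains the factors exp(∓βl/2).
  have e1 : ‖h (β / 2 : ℝ) - Complex.exp (-(((β / 2 : ℝ) - β) * l)) * φ (a * b)‖ ≤
      √(C * (‖b‖ * ‖a'‖) + Real.exp (β * l) * (C * (‖a‖ * ‖b‖))) *
        √(C * (‖a' - a‖ * ‖b‖)) := by
    refine norm_le_sqrt_mul_sqrt_of_strip
      (f := fun w => h w - Complex.exp (-((w - β) * l)) * φ (a * b))
      (g := fun x => C * (‖b‖ * ‖F (Complex.I * x)‖) +
        Real.exp (-((x - β) * l)) * (C * (‖a‖ * ‖b‖)))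
      hβ (by fun_prop) (by fun_prop) (fun w => ?_) (fun s => ?_) (fun s => ?_)
    · refine (norm_sub_le _ _).trans (add_le_add (hh w) ?_)
      rw [norm_mul, hexp]
      simp only [Complex.sub_re, Complex.ofReal_re]
      gcongr
      exact hmul _ _
    · refine (norm_sub_le _ _).trans (add_le_add ?_ ?_)
      · rw [hh0]
        refine (hmul _ _).trans_eq ?_
        rw [α.norm_aut]
      · rw [norm_mul, hexp]
        simp only [Complex.sub_re, Complex.ofReal_re, Complex.mul_re, Complex.I_re, zero_mul,
          Complex.I_im, Complex.ofReal_im, mul_zero, sub_zero, zero_sub, neg_mul, neg_neg]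
        gcongr
        exact hmul _ _
    · have : h (β + Complex.I * s) - Complex.exp (-((β + Complex.I * s - β) * l)) * φ (a * b) =
          φ (α.aut (-s) (a' - a) * b) := by
        rw [hh1, haut, _root_.sub_mul (α.aut (-s) a'), map_sub, smul_mul_assoc, map_smul,
          smul_eq_mul]
        simp
      rw [this]
      refine (hmul _ _).trans_eq ?_
      rw [α.norm_aut]
  have hexp0 : Complex.exp (-((β / 2 : ℝ) * l)) = Complex.exp (-(β / 2 * l)) := by
    push_cast
    rfl
  have hexp1 : Complex.exp (-(((β / 2 : ℝ) - β) * l)) = Complex.exp (β / 2 * l) := by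
    push_cast
    ring_nf
  rw [hexp0] at e0
  rw [hexp1] at e1
  rw [norm_sub_rev] at e0
  exact (norm_sub_le_norm_sub_add_norm_sub _ _ _).trans (add_le_add e0 e1)

/-- The KMS condition for eigenvectors of the dynamics, against arbitrary elements. -/
theorem IsKMS.map_eigenvector_mul {β l : ℝ} (hβ : 0 < β) {φ : A →ₚ[ℂ] ℂ} (h : IsKMS α β φ)
    {a : A} (ha : ∀ t : ℝ, α.aut t a = Complex.exp (Complex.I * t * l) • a) (b : A) :
    φ (a * b) = Real.exp (-(β * l)) * φ (b * a) := by
  obtain ⟨-, -, D, hD, hinv, han, hkms⟩ := h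
  have hφ : Continuous φ := map_continuous φ
  suffices hb : ∀ b ∈ D, φ (a * b) = Real.exp (-(β * l)) * φ (b * a) from
    congrFun (Continuous.ext_on (f := fun b => φ (a * b))
      (g := fun b => Real.exp (-(β * l)) * φ (b * a)) hD (by fun_prop) (by fun_prop)
      fun b hbD => hb b hbD) b
  intro b hb
  obtain ⟨C, hC⟩ := PositiveLinearMap.exists_norm_apply_le φ
  obtain ⟨u, hu, hua⟩ := mem_closure_iff_seq_limit.1 (hD a)
  -- The elements u n of D approximate a without being eigenvectors. Invariance of D gives the KMS
  -- condition along their whole orbits, so the preceding bound applies and tends to 0.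
  have key : ‖Complex.exp (-(β / 2 * l)) * φ (b * a) - Complex.exp (β / 2 * l) * φ (a * b)‖ ≤ 0 := by
    choose F hF using fun n => han _ (hu n)
    refine ge_of_tendsto' (x := atTop) ?_ fun n => norm_kms_defect_le hβ hC ha (hF n) (b := b)
      fun t => hkms _ (hinv t _ (hu n)) _ hb _ ((hF n).shift t)
    have h0 : Tendsto (fun n => ‖u n - a‖) atTop (𝓝 0) :=
      tendsto_iff_norm_sub_tendsto_zero.1 hua
    have h1 : Tendsto (fun n => ‖u n‖) atTop (𝓝 ‖a‖) := hua.norm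
    have e0 : Tendsto (fun n => √(C * (‖b‖ * ‖u n - a‖))) atTop (𝓝 0) := by
      simpa using ((h0.const_mul ‖b‖).const_mul (C : ℝ)).sqrt
    have e1 : Tendsto (fun n => √(C * (‖u n - a‖ * ‖b‖))) atTop (𝓝 0) := by
      simpa using ((h0.mul_const ‖b‖).const_mul (C : ℝ)).sqrt
    have e2 := (((h1.mul_const ‖b‖).const_mul (C : ℝ)).add_const
      (Real.exp (-(β * l)) * (C * (‖b‖ * ‖a‖)))).sqrt
    have e3 := (((h1.const_mul ‖b‖).const_mul (C : ℝ)).add_const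
      (Real.exp (β * l) * (C * (‖a‖ * ‖b‖)))).sqrt
    simpa using (e0.mul e2).add (e3.mul e1)
  have key' := sub_eq_zero.1 (norm_le_zero_iff.1 key)
  have := congrArg (fun z => Complex.exp (-(β / 2 * l)) * z) key'
  simp only [← mul_assoc, ← Complex.exp_add] at this
  rw [neg_add_cancel, Complex.exp_zero, one_mul] at this
  rw [← this]
  push_cast
  ring_nf

theorem star_apply_mul_star (φ : A →ₚ[ℂ] ℂ) (a b : A) :
    star (φ (a * star b)) = φ (b * star a) := by
  rw [← map_star φ, star_mul, star_star]

theorem star_apply_star_mul (φ : A →ₚ[ℂ] ℂ) (a b : A) :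
    star (φ (star b * a)) = φ (star a * b) := by
  rw [← map_star φ, star_mul, star_star]

end EigenKMS

/-! ### Closure properties of the KMS condition -/

section SatisfiesKMS

variable {A : Type*} [CStarAlgebra A] [PartialOrder A] {α : TimeEvolution A}

/-- `a` is analytic and satisfies the KMS condition for `φ` against all elements. -/
def SatisfiesKMS (α : TimeEvolution A) (β : ℝ) (φ : A →ₚ[ℂ] ℂ) (a : A) : Prop :=
  ∃ F, IsEntireExtension α a F ∧ ∀ b, φ (a * b) = φ (b * F (Complex.I * β))

theorem satisfiesKMS_of_eigenvector {β l : ℝ} {φ : A →ₚ[ℂ] ℂ} {a : A}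
    (ha : ∀ t : ℝ, α.aut t a = Complex.exp (Complex.I * t * l) • a)
    (h : ∀ b, φ (a * b) = Complex.exp (-(β * l)) * φ (b * a)) : SatisfiesKMS α β φ a := by
  refine ⟨_, isEntireExtension_of_eigenvector ha, fun b => ?_⟩
  rw [h, mul_smul_comm, map_smul, smul_eq_mul, ← mul_assoc, Complex.I_mul_I, neg_one_mul,
    neg_mul]

theorem satisfiesKMS_smul_one (β : ℝ) (φ : A →ₚ[ℂ] ℂ) (r : ℂ) :
    SatisfiesKMS α β φ (r • 1) :=
  ⟨_, isEntireExtension_smul_one r, fun b => by rw [smul_one_mul, mul_smul_one]⟩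

theorem SatisfiesKMS.add {β : ℝ} {φ : A →ₚ[ℂ] ℂ} {x y : A} (hx : SatisfiesKMS α β φ x)
    (hy : SatisfiesKMS α β φ y) : SatisfiesKMS α β φ (x + y) := by
  obtain ⟨F, hF, hx⟩ := hx
  obtain ⟨F', hF', hy⟩ := hy
  refine ⟨fun z => F z + F' z, hF.add hF', fun b => ?_⟩
  rw [add_mul, mul_add, map_add, map_add, hx, hy]

/-- The factors go around one at a time: φ(xyb) = φ(y b x_{iβ}) = φ(b x_{iβ} y_{iβ}). This is why
the condition is imposed against all b. -/
theorem SatisfiesKMS.mul {β : ℝ} {φ : A →ₚ[ℂ] ℂ} {x y : A} (hx : SatisfiesKMS α β φ x)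
    (hy : SatisfiesKMS α β φ y) : SatisfiesKMS α β φ (x * y) := by
  obtain ⟨F, hF, hx⟩ := hx
  obtain ⟨F', hF', hy⟩ := hy
  refine ⟨fun z => F z * F' z, hF.mul hF', fun b => ?_⟩
  rw [mul_assoc x, hx, mul_assoc y, hy, mul_assoc b]

end SatisfiesKMS

/-! ### Reduction of the KMS condition to the generators -/

section KMSToeplitz

variable {G : Type*} [Group G] {P : Submonoid G} {N : P →* ℝ} {hN : ∀ p, 1 ≤ N p}

theorem dynamics_aut_gen (t : ℝ) (p : P) :
    (dynamics N hN).aut t (gen p) = Complex.exp (Complex.I * t * Real.log (N p)) • gen p :=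
  Subtype.ext (timeOp_conj_leftTranslation N hN t p)

theorem dynamics_aut_star_gen (t : ℝ) (p : P) :
    (dynamics N hN).aut t (star (gen p)) =
      Complex.exp (Complex.I * t * (-Real.log (N p) : ℝ)) • star (gen p) := by
  rw [map_star, dynamics_aut_gen, star_smul]
  congr 1
  rw [Complex.star_def, ← Complex.exp_conj]
  simp

theorem exp_neg_mul_log_eq (hN : ∀ p, 1 ≤ N p) (β : ℝ) (p : P) :
    Real.exp (-(β * Real.log (N p))) = N p ^ (-β) := by
  rw [Real.rpow_def_of_pos (zero_lt_one.trans_le (hN p))]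
  ring_nf

variable {φ : reducedAlg P →ₚ[ℂ] ℂ}

theorem IsKMS.map_gen_mul {β : ℝ} (hβ : 0 < β) (h : IsKMS (dynamics N hN) β φ) (p : P)
    (b : reducedAlg P) : φ (gen p * b) = (N p ^ (-β) : ℝ) * φ (b * gen p) := by
  rw [h.map_eigenvector_mul hβ (fun t => dynamics_aut_gen t p) b, exp_neg_mul_log_eq hN]

/-- The adjoint of the relation for L_p, since φ is hermitian and the scalar is real. -/
theorem map_star_gen_mul {β : ℝ} (hN : ∀ p, 1 ≤ N p)
    (h : ∀ p b, φ (gen p * b) = (N p ^ (-β) : ℝ) * φ (b * gen p)) (p : P) (b : reducedAlg P) :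
    φ (star (gen p) * b) = ((N p ^ (-β) : ℝ) : ℂ)⁻¹ * φ (b * star (gen p)) := by
  have h1 := congrArg star (h p (star b))
  rw [star_apply_mul_star, star_mul', star_apply_star_mul, Complex.star_def,
    Complex.conj_ofReal] at h1
  have h0 : ((N p ^ (-β) : ℝ) : ℂ) ≠ 0 :=
    Complex.ofReal_ne_zero.2 (Real.rpow_pos_of_pos (zero_lt_one.trans_le (hN p)) _).ne'
  rw [h1, inv_mul_cancel_left₀ h0]

theorem ofReal_rpow_neg_eq_exp (hN : ∀ p, 1 ≤ N p) (β : ℝ) (p : P) :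
    ((N p ^ (-β) : ℝ) : ℂ) = Complex.exp (-(β * Real.log (N p))) := by
  rw [← exp_neg_mul_log_eq hN]
  push_cast
  rfl

theorem satisfiesKMS_of_mem_polyAlg {β : ℝ}
    (h : ∀ p b, φ (gen p * b) = (N p ^ (-β) : ℝ) * φ (b * gen p)) {a : reducedAlg P}
    (ha : a ∈ polyAlg P) : SatisfiesKMS (dynamics N hN) β φ a := by
  refine polyAlg_induction (fun q => ?_) (fun q => ?_) (fun r => satisfiesKMS_smul_one β φ r)
    (fun x y hx hy => hx.add hy) (fun x y hx hy => hx.mul hy) ha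
  · refine satisfiesKMS_of_eigenvector (fun t => dynamics_aut_gen t q) fun b => ?_
    rw [h, ofReal_rpow_neg_eq_exp hN]
  · refine satisfiesKMS_of_eigenvector (fun t => dynamics_aut_star_gen t q) fun b => ?_
    rw [map_star_gen_mul hN h, ofReal_rpow_neg_eq_exp hN, ← Complex.exp_neg]
    simp

theorem dynamics_aut_mem_polyAlg (t : ℝ) {a : reducedAlg P} (ha : a ∈ polyAlg P) :
    (dynamics N hN).aut t a ∈ polyAlg P := by
  refine polyAlg_induction (p := fun a => (dynamics N hN).aut t a ∈ polyAlg P) (fun q => ?_)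
    (fun q => ?_) (fun r => ?_) (fun x y hx hy => ?_) (fun x y hx hy => ?_) ha
  · rw [dynamics_aut_gen]
    exact (polyAlg P).smul_mem (StarAlgebra.subset_adjoin ℂ _ ⟨q, rfl⟩) _
  · rw [dynamics_aut_star_gen]
    exact (polyAlg P).smul_mem (star_mem (StarAlgebra.subset_adjoin ℂ _ ⟨q, rfl⟩)) _
  · rw [TimeEvolution.aut_smul_one]
    exact (polyAlg P).smul_mem (one_mem _) _
  · rw [map_add]
    exact add_mem hx hy
  · rw [map_mul]
    exact mul_mem hx hy

/-- The elements satisfying the KMS condition are closed under sums and products, so the relation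
for the generators, and hence for their adjoints, gives it on the dense algebra `polyAlg P`. -/
theorem isKMS_of_map_gen_mul {β : ℝ} (hβ : 0 < β) (hφ : IsState φ)
    (h : ∀ p b, φ (gen p * b) = (N p ^ (-β) : ℝ) * φ (b * gen p)) :
    IsKMS (dynamics N hN) β φ := by
  refine ⟨hφ, fun h0 => absurd h0 hβ.ne', (polyAlg P).toNonUnitalStarSubalgebra,
    dense_polyAlg P, fun t a ha => dynamics_aut_mem_polyAlg t ha, fun a ha => ?_,
    fun a ha b _ F hF => ?_⟩
  · obtain ⟨F, hF, -⟩ := satisfiesKMS_of_mem_polyAlg (hN := hN) h ha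
    exact ⟨F, hF⟩
  · obtain ⟨F', hF', hF''⟩ := satisfiesKMS_of_mem_polyAlg (hN := hN) h ha
    rw [hF.unique hF', hF'']

end KMSToeplitz

/-! ### Finiteness of the trace and the spectral gap of N -/

section Summability

variable {G : Type*} [Group G] {P : Submonoid G} {N : P →* ℝ}

theorem posTrace_lt_top_iff (hN : ∀ p, 1 ≤ N p) (β : ℝ≥0) :
    posTrace (expNegH N hN β) < ∞ ↔ Summable fun p => N p ^ (-(β : ℝ)) := by
  have h0 (p : P) : 0 ≤ N p ^ (-(β : ℝ)) := Real.rpow_nonneg (zero_le_one.trans (hN p)) _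
  rw [posTrace_expNegH, lt_top_iff_ne_top]
  refine ⟨fun h => ?_, fun h => h.tsum_ofReal_ne_top⟩
  simpa [ENNReal.toReal_ofReal, h0] using ENNReal.summable_toReal h

theorem exists_summable_of_betaCrit_lt {hN : ∀ p, 1 ≤ N p} {b : ℝ≥0∞} (h : betaCrit N hN < b) :
    ∃ β : ℝ≥0, 0 < β ∧ (β : ℝ≥0∞) < b ∧ Summable fun p => N p ^ (-(β : ℝ)) := by
  obtain ⟨_, ⟨β, ⟨h0, h1⟩, rfl⟩, hb⟩ := sInf_lt_iff.1 h
  exact ⟨β, h0, hb, (posTrace_lt_top_iff hN β).1 h1⟩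

theorem summable_rpow_neg_of_le (hN : ∀ p, 1 ≤ N p) {β β' : ℝ} (h : β ≤ β')
    (hs : Summable fun p => N p ^ (-β)) : Summable fun p => N p ^ (-β') :=
  hs.of_nonneg_of_le (fun p => Real.rpow_nonneg (zero_le_one.trans (hN p)) _)
    fun p => Real.rpow_le_rpow_of_exponent_le (hN p) (neg_le_neg h)

theorem summable_of_betaCrit_lt {hN : ∀ p, 1 ≤ N p} {β : ℝ≥0} (h : betaCrit N hN < β) :
    Summable fun p => N p ^ (-(β : ℝ)) := by
  obtain ⟨β', -, hlt, hs⟩ := exists_summable_of_betaCrit_lt h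
  exact summable_rpow_neg_of_le hN (NNReal.coe_le_coe.2 (ENNReal.coe_lt_coe.1 hlt).le) hs

/-- Summable terms tend to 0 along the cofinite filter, while N(p) ≤ c keeps N(p)^{-β} away from 0.
-/
theorem finite_setOf_le (hN : ∀ p, 1 ≤ N p) {β : ℝ} (hβ : 0 < β)
    (hs : Summable fun p => N p ^ (-β)) (c : ℝ) : {p | N p ≤ c}.Finite := by
  have hc : 0 < max c 1 := lt_max_of_lt_right one_pos
  have h := hs.tendsto_cofinite_zero.eventually_lt_const (Real.rpow_pos_of_pos hc (-β))
  refine (Filter.eventually_cofinite.1 h).subset fun p hp => ?_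
  rw [Set.mem_ofPred_eq, not_lt]
  exact Real.rpow_le_rpow_of_nonpos (zero_lt_one.trans_le (hN p)) (le_max_of_le_left hp)
    (neg_nonpos.2 hβ.le)

/-- If the trace converges for some inverse temperature, then `N` is bounded away from `1`
outside the identity. -/
theorem exists_gap (hN : ∀ p, 1 ≤ N p) (hN1 : ∀ p, N p = 1 → p = 1) {β : ℝ} (hβ : 0 < β)
    (hs : Summable fun p => N p ^ (-β)) : ∃ c, 1 < c ∧ ∀ p, p ≠ 1 → c ≤ N p := by
  have hfin : ({p | N p ≤ 2} ∩ {1}ᶜ).Finite := (finite_setOf_le hN hβ hs 2).inter_of_left _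
  rcases Set.eq_empty_or_nonempty ({p | N p ≤ 2} ∩ {1}ᶜ) with h | h
  · refine ⟨2, one_lt_two, fun p hp => ?_⟩
    by_contra! hlt
    have : p ∈ ({p | N p ≤ 2} ∩ {1}ᶜ) := ⟨hlt.le, hp⟩
    simp [h] at this
  · obtain ⟨q, ⟨hq2, hq1⟩, hmin⟩ := Set.exists_min_image _ N hfin h
    refine ⟨N q, lt_of_le_of_ne (hN q) fun h => hq1 (hN1 q h.symm), fun p hp => ?_⟩
    rcases le_total (N p) 2 with h2 | h2
    · exact hmin p ⟨h2, hp⟩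
    · exact le_trans hq2 h2

end Summability

/-! ### Uniqueness of KMS states -/

section Uniqueness

variable {G : Type*} [Group G] {P : Submonoid G} {N : P →* ℝ} {φ : reducedAlg P →ₚ[ℂ] ℂ}

theorem norm_gen_le (p : P) : ‖gen p‖ ≤ 1 :=
  LinearIsometry.norm_toContinuousLinearMap_le _

theorem norm_gen_mul_star_gen_le (p q : P) : ‖gen p * star (gen q)‖ ≤ 1 := by
  refine (norm_mul_le _ _).trans (mul_le_one₀ (norm_gen_le p) (norm_nonneg _) ?_)
  exact (norm_star (gen q : EllTwo P →L[ℂ] EllTwo P)).trans_le (norm_gen_le q)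

/-- Moving L_p and then L_q* around the word returns the same word multiplied by N(p)^{-β} N(q)^β,
which is not 1. -/
theorem apply_gen_mul_star_gen_of_map_ne (hN : ∀ p, 1 ≤ N p) {β : ℝ} (hβ : β ≠ 0)
    (h : ∀ p b, φ (gen p * b) = (N p ^ (-β) : ℝ) * φ (b * gen p)) {p q : P} (hpq : N p ≠ N q) :
    φ (gen p * star (gen q)) = 0 := by
  have h0 (x : P) : 0 ≤ N x := zero_le_one.trans (hN x)
  have hne : N p ^ (-β) ≠ N q ^ (-β) := fun he =>
    hpq (Real.rpow_left_injOn (neg_ne_zero.2 hβ) (h0 p) (h0 q) he)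
  have hq : ((N q ^ (-β) : ℝ) : ℂ) ≠ 0 :=
    Complex.ofReal_ne_zero.2 (Real.rpow_pos_of_pos (zero_lt_one.trans_le (hN q)) _).ne'
  have h1 := h p (star (gen q))
  rw [map_star_gen_mul hN h, eq_comm, ← mul_assoc, ← sub_eq_zero, ← sub_one_mul] at h1
  refine (mul_eq_zero.1 h1).resolve_left fun h2 => hne ?_
  rw [sub_eq_zero, mul_inv_eq_one₀ hq] at h2
  exact Complex.ofReal_injective h2

/-- Moving L_p around gains a factor at most r, and L_q* L_p is 0 or L_{q'} L_{p'}* with q q' = p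
p'. Cancellation gives q' ≠ p' and N(q') = N(p'), so the step can be repeated. -/
theorem norm_apply_gen_mul_star_gen_le (hP : IsQuasiLattice P) (hN : ∀ p, 1 ≤ N p)
    (hN1 : ∀ p, N p = 1 → p = 1) {β r : ℝ} (hr : ∀ p, p ≠ 1 → N p ^ (-β) ≤ r) {C : ℝ≥0}
    (hC : ∀ x, ‖φ x‖ ≤ C * ‖x‖)
    (h : ∀ p b, φ (gen p * b) = (N p ^ (-β) : ℝ) * φ (b * gen p)) (n : ℕ) :
    ∀ p q : P, p ≠ q → N p = N q → ‖φ (gen p * star (gen q))‖ ≤ r ^ n * C := by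
  induction n with
  | zero =>
    intro p q _ _
    rw [pow_zero, one_mul]
    exact (hC _).trans (mul_le_of_le_one_right C.2 (norm_gen_mul_star_gen_le p q))
  | succ n ih =>
    intro p q hpq hNpq
    -- If p = 1 then N(q) = 1, hence q = 1 = p.
    have hp : p ≠ 1 := by
      rintro rfl
      rw [map_one] at hNpq
      exact hpq (hN1 q hNpq.symm).symm
    have hr0 : 0 ≤ r := (Real.rpow_nonneg (zero_le_one.trans (hN p)) _).trans (hr p hp)
    rw [h]
    rcases hP.star_gen_mul_gen q p with h0 | ⟨q', p', h1, h2⟩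
    · rw [h0, map_zero, mul_zero, norm_zero]
      positivity
    · have hne : q' ≠ p' := by
        rintro rfl
        exact hpq (mul_right_cancel h1).symm
      have hN' : N q' = N p' := by
        have h3 := congrArg N h1
        rw [map_mul, map_mul, hNpq] at h3
        exact mul_left_cancel₀ (zero_lt_one.trans_le (hN q)).ne' h3
      rw [h2, norm_mul, Complex.norm_real, pow_succ', mul_assoc,
        Real.norm_of_nonneg (Real.rpow_nonneg (zero_le_one.trans (hN p)) _)]
      exact mul_le_mul (hr p hp) (ih q' p' hne hN') (norm_nonneg _) hr0

/-- A `KMS_β` functional vanishes on the off-diagonal spanning elements `L_p L_q*`. -/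
theorem apply_gen_mul_star_gen_of_ne (hP : IsQuasiLattice P) (hN : ∀ p, 1 ≤ N p)
    (hN1 : ∀ p, N p = 1 → p = 1) {β c : ℝ} (hβ : 0 < β) (hc : 1 < c)
    (hgap : ∀ p, p ≠ 1 → c ≤ N p)
    (h : ∀ p b, φ (gen p * b) = (N p ^ (-β) : ℝ) * φ (b * gen p)) {p q : P} (hpq : p ≠ q) :
    φ (gen p * star (gen q)) = 0 := by
  by_cases hNpq : N p = N q
  · obtain ⟨C, hC⟩ := PositiveLinearMap.exists_norm_apply_le φ
    have hc0 : 0 < c := zero_lt_one.trans hc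
    have hr (p : P) (hp : p ≠ 1) : N p ^ (-β) ≤ c ^ (-β) :=
      Real.rpow_le_rpow_of_nonpos hc0 (hgap p hp) (neg_nonpos.2 hβ.le)
    have hlim : Tendsto (fun n : ℕ => (c ^ (-β)) ^ n * (C : ℝ)) atTop (𝓝 (0 * C)) :=
      (tendsto_pow_atTop_nhds_zero_of_lt_one (Real.rpow_nonneg hc0.le _)
        (Real.rpow_lt_one_of_one_lt_of_neg hc (neg_neg_of_pos hβ))).mul_const _
    rw [zero_mul] at hlim
    exact norm_le_zero_iff.1 (ge_of_tendsto' hlim fun n =>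
      norm_apply_gen_mul_star_gen_le hP hN hN1 hr hC h n p q hpq hNpq)
  · exact apply_gen_mul_star_gen_of_map_ne hN hβ.ne' h hNpq

theorem apply_gen_mul_star_gen_self (hφ : IsState φ) {β : ℝ}
    (h : ∀ p b, φ (gen p * b) = (N p ^ (-β) : ℝ) * φ (b * gen p)) (p : P) :
    φ (gen p * star (gen p)) = (N p ^ (-β) : ℝ) := by
  rw [h, star_gen_mul_gen, hφ, mul_one]

theorem IsKMS.eq (hP : IsQuasiLattice P) {hN : ∀ p, 1 ≤ N p}
    (hN1 : ∀ p, N p = 1 → p = 1) {β : ℝ} (hβ : 0 < β) (hcrit : betaCrit N hN < ∞)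
    {φ ψ : reducedAlg P →ₚ[ℂ] ℂ} (hφ : IsKMS (dynamics N hN) β φ)
    (hψ : IsKMS (dynamics N hN) β ψ) : φ = ψ := by
  obtain ⟨β', hβ', -, hs⟩ := exists_summable_of_betaCrit_lt hcrit
  obtain ⟨c, hc, hgap⟩ := exists_gap hN hN1 (NNReal.coe_pos.2 hβ') hs
  refine hP.positiveLinearMap_ext fun p q => ?_
  rcases eq_or_ne p q with rfl | hpq
  · rw [apply_gen_mul_star_gen_self hφ.1 (hφ.map_gen_mul hβ),
      apply_gen_mul_star_gen_self hψ.1 (hψ.map_gen_mul hβ)]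
  · rw [apply_gen_mul_star_gen_of_ne hP hN hN1 hβ hc hgap (hφ.map_gen_mul hβ) hpq,
      apply_gen_mul_star_gen_of_ne hP hN hN1 hβ hc hgap (hψ.map_gen_mul hβ) hpq]

end Uniqueness

/-! ### Gibbs states above the critical temperature -/

section Gibbs

variable {G : Type*} [Group G] {P : Submonoid G} {N : P →* ℝ} {hN : ∀ p, 1 ≤ N p} {β : ℝ≥0}

theorem expNegH_stdVec (x : P) :
    expNegH N hN β (stdVec x) = ((N x ^ (-(β : ℝ)) : ℝ) : ℂ) • stdVec x := by
  classical
  ext y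
  rw [expNegH_apply, lp.coeFn_smul, Pi.smul_apply, stdVec_apply]
  split_ifs with h
  · rw [h, smul_eq_mul]
  · simp

/-- The diagonal matrix coefficient of an operator. -/
def diagCoeff (X : EllTwo P →L[ℂ] EllTwo P) (x : P) : ℂ := ⟪stdVec x, X (stdVec x)⟫_ℂ

theorem norm_diagCoeff_le (X : EllTwo P →L[ℂ] EllTwo P) (x : P) : ‖diagCoeff X x‖ ≤ ‖X‖ := by
  refine (norm_inner_le_norm _ _).trans ?_
  rw [norm_stdVec, one_mul]
  simpa [norm_stdVec] using X.le_opNorm (stdVec x)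

theorem diagCoeff_one (x : P) : diagCoeff 1 x = 1 := by
  simp [diagCoeff, norm_stdVec, inner_self_eq_norm_sq_to_K]

theorem opTrace_mul_expNegH (X : EllTwo P →L[ℂ] EllTwo P) :
    opTrace (X * expNegH N hN β) = ∑' x, ((N x ^ (-(β : ℝ)) : ℝ) : ℂ) * diagCoeff X x := by
  refine tsum_congr fun x => ?_
  rw [mul_apply_eq_comp, expNegH_stdVec, map_smul, inner_smul_right]
  rfl

theorem opTrace_expNegH :
    opTrace (expNegH N hN β) = ((∑' x, N x ^ (-(β : ℝ)) : ℝ) : ℂ) := by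
  rw [← one_mul (expNegH N hN β), opTrace_mul_expNegH, Complex.ofReal_tsum]
  simp [diagCoeff_one]

theorem rpow_nonneg_of_one_le (hN : ∀ p, 1 ≤ N p) (s : ℝ) (x : P) : 0 ≤ N x ^ s :=
  Real.rpow_nonneg (zero_le_one.trans (hN x)) _

theorem norm_rpow_mul_diagCoeff_le (hN : ∀ p, 1 ≤ N p) (s : ℝ) (X : EllTwo P →L[ℂ] EllTwo P)
    (x : P) : ‖((N x ^ s : ℝ) : ℂ) * diagCoeff X x‖ ≤ N x ^ s * ‖X‖ := by
  rw [norm_mul, Complex.norm_real, Real.norm_of_nonneg (rpow_nonneg_of_one_le hN s x)]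
  exact mul_le_mul_of_nonneg_left (norm_diagCoeff_le X x) (rpow_nonneg_of_one_le hN s x)

theorem summable_rpow_mul_diagCoeff (hN : ∀ p, 1 ≤ N p) {s : ℝ}
    (hs : Summable fun p => N p ^ s) (X : EllTwo P →L[ℂ] EllTwo P) :
    Summable fun x => ((N x ^ s : ℝ) : ℂ) * diagCoeff X x :=
  Summable.of_norm_bounded (hs.mul_right _) (norm_rpow_mul_diagCoeff_le hN s X)

theorem one_le_tsum_rpow (hN : ∀ p, 1 ≤ N p) {s : ℝ} (hs : Summable fun p => N p ^ s) :
    1 ≤ ∑' x, N x ^ s := by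
  simpa using hs.le_tsum 1 fun x _ => rpow_nonneg_of_one_le hN s x

theorem opTrace_expNegH_ne_zero (hs : Summable fun p => N p ^ (-(β : ℝ))) :
    opTrace (expNegH N hN β) ≠ 0 := by
  rw [opTrace_expNegH]
  exact Complex.ofReal_ne_zero.2 (zero_lt_one.trans_le (one_le_tsum_rpow hN hs)).ne'

/-- The Gibbs functional as a positive linear functional on `B(ℓ²(P))`. -/
def gibbsState (hN : ∀ p, 1 ≤ N p) (hs : Summable fun p => N p ^ (-(β : ℝ))) :
    (EllTwo P →L[ℂ] EllTwo P) →ₚ[ℂ] ℂ :=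
  PositiveLinearMap.mk₀
    { toFun := gibbs N hN β
      map_add' := fun X Y => by
        simp only [gibbs, opTrace_mul_expNegH]
        rw [← mul_add, ← (summable_rpow_mul_diagCoeff hN hs X).tsum_add
          (summable_rpow_mul_diagCoeff hN hs Y)]
        simp [diagCoeff, mul_add]
      map_smul' := fun c X => by
        simp only [gibbs, opTrace_mul_expNegH, RingHom.id_apply, smul_eq_mul]
        rw [mul_left_comm c, ← tsum_mul_left (a := c)]
        simp only [diagCoeff, smul_apply, inner_smul_right, mul_left_comm c] }
    (fun X hX => by
      change 0 ≤ (opTrace (expNegH N hN β))⁻¹ * opTrace (X * expNegH N hN β)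
      rw [opTrace_expNegH, ← Complex.ofReal_inv, opTrace_mul_expNegH]
      refine mul_nonneg (Complex.zero_le_real.2
        (inv_nonneg.2 (tsum_nonneg (rpow_nonneg_of_one_le hN _)))) (tsum_nonneg fun x => ?_)
      exact mul_nonneg (Complex.zero_le_real.2 (rpow_nonneg_of_one_le hN _ x))
        (((ContinuousLinearMap.nonneg_iff_isPositive _).1 hX).inner_nonneg_right _))

theorem gibbsState_apply (hs : Summable fun p => N p ^ (-(β : ℝ)))
    (X : EllTwo P →L[ℂ] EllTwo P) : gibbsState hN hs X = gibbs N hN β X := rfl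

theorem gibbs_eq (X : EllTwo P →L[ℂ] EllTwo P) :
    gibbs N hN β X = ((∑' x, N x ^ (-(β : ℝ)) : ℝ) : ℂ)⁻¹ *
      ∑' x, ((N x ^ (-(β : ℝ)) : ℝ) : ℂ) * diagCoeff X x := by
  rw [gibbs, opTrace_expNegH, opTrace_mul_expNegH]

theorem isState_gibbsState (hs : Summable fun p => N p ^ (-(β : ℝ))) :
    IsState (gibbsState hN hs) := by
  rw [IsState, gibbsState_apply, gibbs, one_mul, inv_mul_cancel₀ (opTrace_expNegH_ne_zero hs)]

theorem norm_gibbs_le (hs : Summable fun p => N p ^ (-(β : ℝ)))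
    (X : EllTwo P →L[ℂ] EllTwo P) : ‖gibbs N hN β X‖ ≤ ‖X‖ := by
  have h1 := zero_lt_one.trans_le (one_le_tsum_rpow hN hs)
  rw [gibbs_eq, norm_mul, norm_inv, Complex.norm_real, Real.norm_of_nonneg h1.le,
    inv_mul_le_iff₀ h1, ← tsum_mul_right]
  exact tsum_of_norm_bounded (hs.mul_right _).hasSum (norm_rpow_mul_diagCoeff_le hN _ X)

theorem opTrace_expNegH_mul_gibbs_vacuumProj (hs : Summable fun p => N p ^ (-(β : ℝ))) :
    opTrace (expNegH N hN β) * gibbs N hN β (vacuumProj P) = 1 := by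
  classical
  rw [gibbs, mul_inv_cancel_left₀ (opTrace_expNegH_ne_zero hs), opTrace_mul_expNegH,
    tsum_eq_single 1 fun x hx => ?_]
  · simp [diagCoeff, vacuumProj, Submodule.starProjection_unit_singleton, norm_stdVec,
      inner_self_eq_norm_sq_to_K]
  · rw [diagCoeff, vacuumProj, Submodule.starProjection_unit_singleton ℂ (norm_stdVec 1),
      inner_smul_right, inner_stdVec_left, stdVec_apply, if_neg hx.symm]
    simp

/-- The coefficient ⟨ε_x, L_p X ε_x⟩ vanishes unless x = p y; then it equals ⟨ε_y, X L_p ε_y⟩, and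
multiplicativity of N splits off N(p)^{-β}. -/
theorem gibbs_leftTranslation_mul (p : P) (X : EllTwo P →L[ℂ] EllTwo P) :
    gibbs N hN β (leftTranslation p * X) =
      (N p ^ (-(β : ℝ)) : ℝ) * gibbs N hN β (X * leftTranslation p) := by
  have hcoeff (x : P) : diagCoeff (leftTranslation p * X) x =
      ⟪star (leftTranslation p) (stdVec x), X (stdVec x)⟫_ℂ := by
    rw [ContinuousLinearMap.star_eq_adjoint, ContinuousLinearMap.adjoint_inner_left]
    rfl
  rw [gibbs_eq, gibbs_eq, mul_left_comm, ← tsum_mul_left (a := ((N p ^ (-(β : ℝ)) : ℝ) : ℂ)),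
    ← (mul_right_injective p).tsum_eq (f := fun x =>
      ((N x ^ (-(β : ℝ)) : ℝ) : ℂ) * diagCoeff (leftTranslation p * X) x)]
  · congr 1
    refine tsum_congr fun x => ?_
    rw [hcoeff, star_leftTranslation_stdVec_mul, ← mul_assoc, ← Complex.ofReal_mul, map_mul,
      Real.mul_rpow (zero_le_one.trans (hN p)) (zero_le_one.trans (hN x)),
      ← leftTranslation_stdVec]
    rfl
  · intro x hx
    by_contra hne
    refine hx ?_
    dsimp only
    rw [hcoeff, star_leftTranslation_stdVec_of_forall_ne fun y hy => hne ⟨y, hy⟩, inner_zero_left,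
      mul_zero]

theorem isState_restrictState {ψ : (EllTwo P →L[ℂ] EllTwo P) →ₚ[ℂ] ℂ} (hψ : IsState ψ) :
    IsState (restrictState ψ) := hψ

theorem restrictState_gibbsState_gen_mul (hs : Summable fun p => N p ^ (-(β : ℝ))) (p : P)
    (b : reducedAlg P) : restrictState (gibbsState hN hs) (gen p * b) =
      (N p ^ (-(β : ℝ)) : ℝ) * restrictState (gibbsState hN hs) (b * gen p) :=
  gibbs_leftTranslation_mul p (b : EllTwo P →L[ℂ] EllTwo P)

theorem isKMS_gibbsState (hβ : 0 < β) (hs : Summable fun p => N p ^ (-(β : ℝ))) :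
    IsKMS (dynamics N hN) β (restrictState (gibbsState hN hs)) :=
  isKMS_of_map_gen_mul (NNReal.coe_pos.2 hβ) (isState_restrictState (isState_gibbsState hs))
    (restrictState_gibbsState_gen_mul hs)

end Gibbs

/-! ### Weak* limits of positive functionals -/

section WeakStarLimit

variable {A : Type*} [CStarAlgebra A] [PartialOrder A] [StarOrderedRing A]

/-- Weak* compactness of the contractive positive functionals, along an ultrafilter. -/
theorem exists_tendsto_ultrafilter {ι : Type*} (U : Ultrafilter ι) (φ : ι → (A →ₚ[ℂ] ℂ))
    (hφ : ∀ i a, ‖φ i a‖ ≤ ‖a‖) :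
    ∃ ψ : A →ₚ[ℂ] ℂ, ∀ a, Tendsto (fun i => φ i a) U (𝓝 (ψ a)) := by
  have hlim (a : A) : ∃ z, Tendsto (fun i => φ i a) U (𝓝 z) := by
    obtain ⟨z, -, hz⟩ := (isCompact_closedBall (0 : ℂ) ‖a‖).ultrafilter_le_nhds
      (U.map fun i => φ i a) (by
        rw [Ultrafilter.coe_map, Filter.le_principal_iff, Filter.mem_map]
        exact Filter.univ_mem' fun i => by simpa using hφ i a)
    exact ⟨z, hz⟩
  choose f hf using hlim
  refine ⟨PositiveLinearMap.mk₀
    { toFun := f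
      map_add' := fun a b => tendsto_nhds_unique (hf (a + b)) (by
        simpa only [map_add] using (hf a).add (hf b))
      map_smul' := fun c a => tendsto_nhds_unique (hf (c • a)) (by
        simpa only [map_smul, RingHom.id_apply] using (hf a).const_smul c) }
    fun a ha => ge_of_tendsto' (hf a) fun i => (φ i).map_nonneg ha, hf⟩

end WeakStarLimit

/-! ### A KMS state at the critical temperature -/

section Critical

variable {G : Type*} [Group G] {P : Submonoid G} {N : P →* ℝ} {hN : ∀ p, 1 ≤ N p}

/-- An ultrafilter limit of the Gibbs states at β_c + 1/(n+1): the relation φ(L_p b) = N(p)^{-β} φ(b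
L_p) survives because N(p)^{-β} is continuous in β. -/
theorem exists_isKMS_betaCrit (h0 : 0 < betaCrit N hN) (hcrit : betaCrit N hN < ∞) :
    ∃ φ, IsKMS (dynamics N hN) (betaCrit N hN).toReal φ := by
  let b : ℕ → ℝ≥0 := fun n => (betaCrit N hN).toNNReal + 1 / ((n : ℝ≥0) + 1)
  have hb (n : ℕ) : betaCrit N hN < b n := by
    rw [← ENNReal.coe_toNNReal hcrit.ne, ENNReal.coe_lt_coe]
    exact lt_add_of_pos_right _ (by positivity)
  have hblim : Tendsto (fun n => (b n : ℝ)) atTop (𝓝 (betaCrit N hN).toReal) := by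
    have := (tendsto_one_div_add_atTop_nhds_zero_nat (𝕜 := ℝ)).const_add (betaCrit N hN).toReal
    simpa [b, ENNReal.toReal] using this
  have hs (n : ℕ) := summable_of_betaCrit_lt (hb n)
  obtain ⟨φ, hφ⟩ := exists_tendsto_ultrafilter (Filter.hyperfilter ℕ)
    (fun n => restrictState (gibbsState hN (hs n)))
    fun n a => norm_gibbs_le (hs n) (a : EllTwo P →L[ℂ] EllTwo P)
  refine ⟨φ, isKMS_of_map_gen_mul (ENNReal.toReal_pos h0.ne' hcrit.ne) ?_ fun p a => ?_⟩
  · refine tendsto_nhds_unique (hφ 1) ?_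
    have h1 (n : ℕ) : restrictState (gibbsState hN (hs n)) 1 = 1 := isState_gibbsState (hs n)
    simpa only [h1] using tendsto_const_nhds
  · refine tendsto_nhds_unique (hφ _) ?_
    simp only [restrictState_gibbsState_gen_mul]
    refine Tendsto.mul ?_ (hφ _)
    refine (Complex.continuous_ofReal.tendsto _).comp ?_
    exact (tendsto_const_nhds.rpow (hblim.mono_left Nat.hyperfilter_le_atTop).neg
      (Or.inl (zero_lt_one.trans_le (hN p)).ne'))

end Critical

/-! ### Ground states and the limit at infinite β -/

section Ground

variable {A : Type*} [CStarAlgebra A] [PartialOrder A] {α : TimeEvolution A}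

/-- A ground state annihilates the left ideal generated by an eigenvector of the dynamics with
negative frequency. -/
theorem IsGroundState.apply_mul_eigenvector {φ : A →ₚ[ℂ] ℂ} (h : IsGroundState α φ) {a : A} {l : ℝ}
    (hl : l < 0) (ha : ∀ t : ℝ, α.aut t a = Complex.exp (Complex.I * t * l) • a) (y : A) :
    φ (y * a) = 0 := by
  obtain ⟨C, hC⟩ := h.2 a y _ (isEntireExtension_of_eigenvector ha)
  by_contra hne
  have hpos : 0 < ‖φ (y * a)‖ := norm_pos_iff.2 hne
  -- At z = is the extension multiplies a by exp(-ls), which is unbounded because l < 0.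
  have hle (s : ℝ) (hs : 0 < s) : Real.exp (-l * s) * ‖φ (y * a)‖ ≤ C := by
    have h1 := hC (Complex.I * s) (by simpa using hs)
    rw [mul_smul_comm, map_smul, norm_smul, Complex.norm_exp] at h1
    convert h1 using 3
    rw [← mul_assoc, Complex.I_mul_I]
    simp [mul_comm]
  have hlim : Tendsto (fun s : ℝ => Real.exp (-l * s) * ‖φ (y * a)‖) atTop atTop :=
    (Real.tendsto_exp_atTop.comp (tendsto_id.const_mul_atTop (neg_pos.2 hl))).atTop_mul_const hpos
  obtain ⟨s, hs, hs'⟩ := ((hlim.eventually_gt_atTop C).and (eventually_gt_atTop 0)).exists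
  exact (hle s hs').not_gt hs

variable {G : Type*} [Group G] {P : Submonoid G} {N : P →* ℝ} {hN : ∀ p, 1 ≤ N p}

/-- The matrix coefficient `a ↦ ⟨a ε_e, ε_p⟩` as a continuous functional on `C*_λ(P)`. -/
def vacuumCoeff (p : P) : reducedAlg P →L[ℂ] ℂ :=
  LinearMap.mkContinuous
    { toFun := fun a => (a : EllTwo P →L[ℂ] EllTwo P) (stdVec 1) p
      map_add' := fun a b => rfl
      map_smul' := fun c a => rfl } 1 fun a => by
    rw [one_mul]
    refine (lp.norm_apply_le_norm (by norm_num) _ p).trans ?_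
    simpa [norm_stdVec] using (a : EllTwo P →L[ℂ] EllTwo P).le_opNorm (stdVec 1)

/-- N(e) = 1, so U_t fixes ε_e and only the phase at ε_p remains. -/
theorem vacuumCoeff_aut (t : ℝ) (a : reducedAlg P) (p : P) :
    vacuumCoeff p ((dynamics N hN).aut t a) =
      Complex.exp (Complex.I * t * Real.log (N p)) * vacuumCoeff p a := by
  change timeOp N t ((a : EllTwo P →L[ℂ] EllTwo P) (star (timeOp N t) (stdVec 1))) p = _
  rw [star_timeOp, timeOp_stdVec, phase, map_one, Real.log_one]
  simp only [Complex.ofReal_zero, mul_zero, Complex.exp_zero, one_smul]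
  rfl

theorem IsEntireExtension.vacuumCoeff_apply {a : reducedAlg P} {F : ℂ → reducedAlg P}
    (h : IsEntireExtension (dynamics N hN) a F) (z : ℂ) (p : P) :
    vacuumCoeff p (F z) = Complex.exp (Complex.I * z * Real.log (N p)) * vacuumCoeff p a := by
  refine congrFun (Differentiable.eq_of_eqOn_real (f := fun z => vacuumCoeff p (F z))
    (g := fun z => Complex.exp (Complex.I * z * Real.log (N p)) * vacuumCoeff p a)
    ((vacuumCoeff p).differentiable.comp h.1) (by fun_prop) fun t => ?_) z
  rw [h.2, vacuumCoeff_aut]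

/-- Each coordinate is multiplied by N(p)^{iz}, of modulus N(p)^{-Im z} ≤ 1. This contraction
property makes the Fock state a ground state. -/
theorem IsEntireExtension.norm_apply_vacuum_le {a : reducedAlg P} {F : ℂ → reducedAlg P}
    (h : IsEntireExtension (dynamics N hN) a F) {z : ℂ} (hz : 0 ≤ z.im) :
    ‖(F z : EllTwo P →L[ℂ] EllTwo P) (stdVec 1)‖ ≤
      ‖(a : EllTwo P →L[ℂ] EllTwo P) (stdVec 1)‖ := by
  refine lp.norm_mono (by norm_num) fun p => ?_
  change ‖vacuumCoeff p (F z)‖ ≤ ‖vacuumCoeff p a‖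
  rw [h.vacuumCoeff_apply, norm_mul, Complex.norm_exp]
  refine mul_le_of_le_one_left (norm_nonneg _) (Real.exp_le_one_iff.2 ?_)
  have := mul_nonneg hz (Real.log_nonneg (hN p))
  simpa using this

theorem fockState_apply (a : reducedAlg P) :
    fockState a = ⟪stdVec (1 : P), (a : EllTwo P →L[ℂ] EllTwo P) (stdVec 1)⟫_ℂ := rfl

theorem isState_fockState : IsState (fockState (P := P)) := by
  rw [IsState, fockState_apply]
  exact diagCoeff_one 1

theorem isGroundState_fockState : IsGroundState (dynamics N hN) fockState := by
  refine ⟨isState_fockState, fun x y F hF => ⟨‖(y : EllTwo P →L[ℂ] EllTwo P)‖ *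
    ‖(x : EllTwo P →L[ℂ] EllTwo P) (stdVec 1)‖, fun z hz => ?_⟩⟩
  rw [fockState_apply]
  refine (norm_inner_le_norm _ _).trans ?_
  rw [norm_stdVec, one_mul]
  refine ((y : EllTwo P →L[ℂ] EllTwo P).le_opNorm
    ((F z : EllTwo P →L[ℂ] EllTwo P) (stdVec 1))).trans ?_
  exact mul_le_mul_of_nonneg_left (hF.norm_apply_vacuum_le hz.le) (norm_nonneg _)

theorem IsGroundState.apply_mul_star_gen (hN1 : ∀ p, N p = 1 → p = 1)
    {φ : reducedAlg P →ₚ[ℂ] ℂ} (h : IsGroundState (dynamics N hN) φ) {q : P} (hq : q ≠ 1)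
    (y : reducedAlg P) : φ (y * star (gen q)) = 0 := by
  refine h.apply_mul_eigenvector ?_ (fun t => dynamics_aut_star_gen t q) y
  exact neg_neg_of_pos (Real.log_pos (lt_of_le_of_ne (hN q) fun h1 => hq (hN1 q h1.symm)))

/-- A ground state kills L_p L_q* when q ≠ 1, and by conjugation when p ≠ 1. The only other word is
the identity. -/
theorem IsGroundState.eq (hP : IsQuasiLattice P) (hN1 : ∀ p, N p = 1 → p = 1)
    {φ ψ : reducedAlg P →ₚ[ℂ] ℂ} (hφ : IsGroundState (dynamics N hN) φ)
    (hψ : IsGroundState (dynamics N hN) ψ) : φ = ψ := by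
  refine hP.positiveLinearMap_ext fun p q => ?_
  by_cases hq : q = 1
  · by_cases hp : p = 1
    · rw [hp, hq, gen_one, star_one, mul_one, hφ.1, hψ.1]
    · rw [← star_apply_mul_star φ, ← star_apply_mul_star ψ, hφ.apply_mul_star_gen hN1 hp,
        hψ.apply_mul_star_gen hN1 hp]
  · rw [hφ.apply_mul_star_gen hN1 hq, hψ.apply_mul_star_gen hN1 hq]

/-- Dominated convergence with majorant N(x)^{-β₀}‖X‖: every weight tends to 0 except the constant
weight 1 at the identity. -/
theorem tendsto_tsum_rpow_mul_diagCoeff (hN : ∀ p, 1 ≤ N p) (hN1 : ∀ p, N p = 1 → p = 1) {β₀ : ℝ}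
    (hs : Summable fun p => N p ^ (-β₀)) (X : EllTwo P →L[ℂ] EllTwo P) :
    Tendsto (fun β : ℝ => ∑' x, ((N x ^ (-β) : ℝ) : ℂ) * diagCoeff X x) atTop
      (𝓝 (diagCoeff X 1)) := by
  classical
  have hsum : ∑' x : P, (if x = 1 then diagCoeff X 1 else 0) = diagCoeff X 1 := tsum_ite_eq 1 _
  rw [← hsum]
  refine tendsto_tsum_of_dominated_convergence (hs.mul_right ‖X‖) (fun x => ?_) ?_
  · split_ifs with hx
    · rw [hx, map_one]
      simp
    · have h1 : 1 < N x := lt_of_le_of_ne (hN x) fun h => hx (hN1 x h.symm)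
      have h2 : Tendsto (fun β : ℝ => N x ^ (-β)) atTop (𝓝 0) := by
        have := tendsto_rpow_atTop_of_base_lt_one (N x)⁻¹
          (by linarith [inv_pos.2 (zero_lt_one.trans h1)]) (inv_lt_one_of_one_lt₀ h1)
        refine this.congr fun β => ?_
        rw [Real.inv_rpow (zero_le_one.trans (hN x)), Real.rpow_neg (zero_le_one.trans (hN x))]
      have h3 := ((Complex.continuous_ofReal.tendsto 0).comp h2).mul_const (diagCoeff X x)
      simpa using h3
  · filter_upwards [eventually_ge_atTop β₀] with β hβ x
    refine (norm_rpow_mul_diagCoeff_le hN _ X x).trans ?_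
    exact mul_le_mul_of_nonneg_right
      (Real.rpow_le_rpow_of_exponent_le (hN x) (neg_le_neg hβ)) (norm_nonneg _)

theorem isKMSInfty_fockState (hN1 : ∀ p, N p = 1 → p = 1) (hcrit : betaCrit N hN < ∞) :
    IsKMSInfty (dynamics N hN) fockState := by
  obtain ⟨β₀, hβ₀, -, hs⟩ := exists_summable_of_betaCrit_lt hcrit
  -- Below β₀ the Fock state is only a filler value; the limit concerns large β.
  have hex (β : ℝ) : ∃ ψ : reducedAlg P →ₚ[ℂ] ℂ, (β₀ : ℝ) ≤ β → IsKMS (dynamics N hN) β ψ ∧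
      ∀ a, ψ a = gibbs N hN β.toNNReal (a : EllTwo P →L[ℂ] EllTwo P) := by
    by_cases hβ : (β₀ : ℝ) ≤ β
    · have hpos : 0 < β := (NNReal.coe_pos.2 hβ₀).trans_le hβ
      have hcoe : (β.toNNReal : ℝ) = β := Real.coe_toNNReal β hpos.le
      have hs' : Summable fun p => N p ^ (-(β.toNNReal : ℝ)) :=
        summable_rpow_neg_of_le hN (by rwa [hcoe]) hs
      have hK := isKMS_gibbsState (hN := hN) (Real.toNNReal_pos.2 hpos) hs'
      rw [hcoe] at hK
      exact ⟨_, fun _ => ⟨hK, fun a => rfl⟩⟩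
    · exact ⟨fockState, fun h => absurd h hβ⟩
  choose ψ hψ using hex
  refine ⟨isState_fockState, ψ, ?_, fun a => ?_⟩
  · filter_upwards [eventually_ge_atTop (β₀ : ℝ)] with β hβ
    exact (hψ β hβ).1
  · have h1 := tendsto_tsum_rpow_mul_diagCoeff hN hN1 hs (1 : EllTwo P →L[ℂ] EllTwo P)
    have h2 := tendsto_tsum_rpow_mul_diagCoeff hN hN1 hs (a : EllTwo P →L[ℂ] EllTwo P)
    rw [diagCoeff_one] at h1
    have h3 := (h1.inv₀ one_ne_zero).mul h2
    rw [inv_one, one_mul] at h3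
    refine h3.congr' ?_
    filter_upwards [eventually_ge_atTop (β₀ : ℝ)] with β hβ
    have hcoe : (β.toNNReal : ℝ) = β :=
      Real.coe_toNNReal β ((NNReal.coe_pos.2 hβ₀).trans_le hβ).le
    rw [(hψ β hβ).2, gibbs_eq, hcoe, Complex.ofReal_tsum]
    simp only [diagCoeff_one, mul_one]

end Ground

/-! ### A criterion for type I_∞ -/

section TypeI

variable {A : Type*} [CStarAlgebra A] {H : Type*} [NormedAddCommGroup H] [InnerProductSpace ℂ H]
  [CompleteSpace H] {π : A →⋆ₐ[ℂ] (H →L[ℂ] H)}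

theorem mem_generatedVN_iff {x : H →L[ℂ] H} : x ∈ generatedVN π ↔
    ∀ y : H →L[ℂ] H, (∀ a, π a * y = y * π a) → y * x = x * y := by
  rw [← SetLike.mem_coe, coe_generatedVN, Set.mem_centralizer_iff]
  simp only [Set.mem_centralizer_iff, Set.forall_mem_range]

theorem map_mem_generatedVN (a : A) : π a ∈ generatedVN π :=
  mem_generatedVN_iff.2 fun _ hy => (hy a).symm

/-- Since π(A) is self-adjoint, the orthogonal complement of an invariant subspace is invariant too.
-/
theorem starProjection_mul_comm_of_invariant {W : Submodule ℂ H} [W.HasOrthogonalProjection]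
    (hW : ∀ a, ∀ ξ ∈ W, π a ξ ∈ W) (a : A) :
    π a * W.starProjection = W.starProjection * π a := by
  have hQ : star W.starProjection = W.starProjection :=
    (isStarProjection_starProjection (U := W)).isSelfAdjoint.star_eq
  have h1 (b : A) : W.starProjection * (π b * W.starProjection) = π b * W.starProjection := by
    ext ξ
    exact Submodule.starProjection_eq_self_iff.2 (hW b _ (Submodule.starProjection_apply_mem W ξ))
  have h2 := congrArg star (h1 (star a))
  rw [star_mul, star_mul, hQ, ← map_star, star_star, mul_assoc, h1] at h2
  exact h2

theorem apply_mem_of_mem_generatedVN {W : Submodule ℂ H} [W.HasOrthogonalProjection]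
    (hW : ∀ a, ∀ ξ ∈ W, π a ξ ∈ W) {x : H →L[ℂ] H} (hx : x ∈ generatedVN π) {ξ : H}
    (hξ : ξ ∈ W) : x ξ ∈ W := by
  have h := mem_generatedVN_iff.1 hx _ (starProjection_mul_comm_of_invariant hW)
  have h1 := congrArg (fun T : H →L[ℂ] H => T ξ) h
  simp only [mul_apply_eq_comp, Submodule.starProjection_eq_self_iff.2 hξ] at h1
  exact Submodule.starProjection_eq_self_iff.1 h1

theorem starProjection_mem_generatedVN {S : Submodule ℂ H} [S.HasOrthogonalProjection]
    (hS : ∀ y : H →L[ℂ] H, (∀ a, π a * y = y * π a) → ∀ ξ ∈ S, y ξ ∈ S) :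
    S.starProjection ∈ generatedVN π := by
  rw [VonNeumannAlgebra.IsStarProjection.mem_iff isStarProjection_starProjection]
  intro y hy
  rw [Submodule.range_starProjection, Module.End.mem_invtSubmodule_iff_forall_mem_of_mem]
  exact hS y fun a => VonNeumannAlgebra.mem_commutant_iff.1 hy _ (map_mem_generatedVN a)

/-- The cyclic subspace generated by a vector. -/
def cyclicSubspace (π : A →⋆ₐ[ℂ] (H →L[ℂ] H)) (ξ : H) : Submodule ℂ H :=
  (LinearMap.range ((ContinuousLinearMap.apply ℂ H ξ).toLinearMap ∘ₗ
    π.toAlgHom.toLinearMap)).topologicalClosure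

instance (ξ : H) : CompleteSpace (cyclicSubspace π ξ) :=
  (Submodule.isClosed_topologicalClosure _).completeSpace_coe

theorem apply_mem_cyclicSubspace (a : A) (ξ : H) : π a ξ ∈ cyclicSubspace π ξ :=
  Submodule.le_topologicalClosure _ ⟨a, rfl⟩

theorem self_mem_cyclicSubspace (ξ : H) : ξ ∈ cyclicSubspace π ξ := by
  simpa using apply_mem_cyclicSubspace (π := π) 1 ξ

theorem cyclicSubspace_le {ξ : H} {W : Submodule ℂ H} (hW : IsClosed (W : Set H))
    (h : ∀ a, π a ξ ∈ W) : cyclicSubspace π ξ ≤ W :=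
  Submodule.topologicalClosure_minimal _ (by rintro _ ⟨a, rfl⟩; exact h a) hW

theorem apply_mem_cyclicSubspace_of_mem {ξ η : H} (a : A) (hη : η ∈ cyclicSubspace π ξ) :
    π a η ∈ cyclicSubspace π ξ := by
  refine cyclicSubspace_le (W := (cyclicSubspace π ξ).comap (π a).toLinearMap) ?_ (fun b => ?_) hη
  · exact (Submodule.isClosed_topologicalClosure _).preimage (π a).continuous
  · change π a (π b ξ) ∈ cyclicSubspace π ξ
    rw [← mul_apply_eq_comp, ← map_mul]
    exact apply_mem_cyclicSubspace _ ξ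

/-- If the compressions of `π(A)` to `S` are scalar, so are those of `π(A)''`. -/
theorem exists_compression_eq_smul {S : Submodule ℂ H} [S.HasOrthogonalProjection]
    (hc : ∀ a, ∃ c : ℂ, ∀ ξ ∈ S, S.starProjection (π a ξ) = c • ξ) {x : H →L[ℂ] H}
    (hx : x ∈ generatedVN π) : ∃ c : ℂ, ∀ ξ ∈ S, S.starProjection (x ξ) = c • ξ := by
  -- An element x of π(A)'' preserves the closed invariant subspace generated by ξ. The compression
  -- sends π(A)ξ into ℂξ, which is closed, so it sends xξ there as well.
  have hmem (ξ : H) (hξ : ξ ∈ S) : S.starProjection (x ξ) ∈ Submodule.span ℂ {ξ} := by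
    have h1 : x ξ ∈ cyclicSubspace π ξ := apply_mem_of_mem_generatedVN
      (fun a η hη => apply_mem_cyclicSubspace_of_mem a hη) hx (self_mem_cyclicSubspace ξ)
    refine cyclicSubspace_le
      (W := (Submodule.span ℂ {ξ}).comap S.starProjection.toLinearMap) ?_ (fun a => ?_) h1
    · exact (Submodule.closed_of_finiteDimensional (Submodule.span ℂ {ξ})).preimage
        S.starProjection.continuous
    · obtain ⟨c, hc⟩ := hc a
      exact Submodule.mem_span_singleton.2 ⟨c, (hc ξ hξ).symm⟩
  let f : S →ₗ[ℂ] S := (S.orthogonalProjectionOnto ∘L x ∘L S.subtypeL).toLinearMap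
  -- Every vector of S is now an eigenvector of the compression, so the eigenvalue is the same
  -- throughout S.
  obtain ⟨c, hf⟩ := LinearMap.exists_eq_smul_id_of_forall_notLinearIndependent (f := f) (by
    intro ξ hind
    obtain ⟨c, hc⟩ := Submodule.mem_span_singleton.1 (hmem ξ ξ.2)
    have h1 := LinearIndependent.pair_iff.1 hind c (-1) (by
      rw [neg_one_smul, ← sub_eq_add_neg, sub_eq_zero]
      exact Subtype.ext hc)
    simp at h1)
  exact ⟨c, fun ξ hξ => congrArg Subtype.val (LinearMap.congr_fun hf ⟨ξ, hξ⟩)⟩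

/-- Invariance under the commutant puts the projection onto S in π(A)'', and scalar compressions
make it minimal. A central z commutes with it, so is a scalar c on S; then z - c kills the total set
π(A)S. The proper isometry π(v) gives infiniteness. -/
theorem isTypeIInftyFactor_of_subspace {S : Submodule ℂ H} [S.HasOrthogonalProjection]
    (hS : ∀ y : H →L[ℂ] H, (∀ a, π a * y = y * π a) → ∀ ξ ∈ S, y ξ ∈ S) (hbot : S ≠ ⊥)
    (hc : ∀ a, ∃ c : ℂ, ∀ ξ ∈ S, S.starProjection (π a ξ) = c • ξ)
    (htot : ∀ W : Submodule ℂ H, IsClosed (W : Set H) → (∀ a, ∀ ξ ∈ S, π a ξ ∈ W) → W = ⊤)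
    {v : A} (hv : star v * v = 1) (hv' : π (v * star v) ≠ 1) :
    IsTypeIInftyFactor (generatedVN π) where
  center_trivial z hz hcomm := by
    obtain ⟨c, hz'⟩ := exists_compression_eq_smul hc hz
    have hzS (ξ : H) (hξ : ξ ∈ S) : z ξ = c • ξ := by
      rw [← hz' ξ hξ]
      have h1 := congrArg (fun T : H →L[ℂ] H => T ξ)
        (hcomm _ (starProjection_mem_generatedVN hS))
      simp only [mul_apply_eq_comp, Submodule.starProjection_eq_self_iff.2 hξ] at h1
      exact h1
    refine ⟨c, sub_eq_zero.1 ?_⟩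
    have htop := htot (LinearMap.ker (z - c • (1 : H →L[ℂ] H)).toLinearMap)
      (z - c • (1 : H →L[ℂ] H)).isClosed_ker fun a ξ hξ => by
        have h1 := congrArg (fun T : H →L[ℂ] H => T ξ) (hcomm _ (map_mem_generatedVN a))
        simp only [mul_apply_eq_comp, hzS ξ hξ, map_smul] at h1
        simp [h1]
    ext ξ
    have : ξ ∈ LinearMap.ker (z - c • (1 : H →L[ℂ] H)).toLinearMap := htop ▸ Submodule.mem_top
    exact this
  exists_minimal := by
    refine ⟨S.starProjection, starProjection_mem_generatedVN hS, isStarProjection_starProjection,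
      fun h0 => hbot ?_, fun x hx => ?_⟩
    · rw [← Submodule.range_starProjection S, h0]
      simp
    · obtain ⟨c, hx'⟩ := exists_compression_eq_smul hc hx
      refine ⟨c, ?_⟩
      ext ξ
      exact hx' _ (Submodule.starProjection_apply_mem S ξ)
  infinite := by
    refine ⟨π v, map_mem_generatedVN v, ?_, ?_⟩
    · rw [← map_star, ← map_mul, hv, map_one]
    · rwa [← map_star, ← map_mul]

end TypeI

/-! ### Vectors of the GNS space -/

section GNS

variable {A : Type*} [CStarAlgebra A] [PartialOrder A] [StarOrderedRing A] (φ : A →ₚ[ℂ] ℂ)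

/-- The vector of the GNS space given by an element of the algebra. -/
def gnsVec : A →ₗ[ℂ] φ.GNS :=
  (UniformSpace.Completion.toComplL (𝕜 := ℂ) (E := φ.PreGNS)).toLinearMap ∘ₗ φ.toPreGNS.toLinearMap

variable {φ}

theorem gnsStarAlgHom_gnsVec (a b : A) : φ.gnsStarAlgHom a (gnsVec φ b) = gnsVec φ (a * b) :=
  φ.gnsNonUnitalStarAlgHom_apply_coe

theorem inner_gnsVec (a b : A) : ⟪gnsVec φ a, gnsVec φ b⟫_ℂ = φ (star a * b) :=
  UniformSpace.Completion.inner_coe _ _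

theorem norm_gnsVec_sq (a : A) : ((‖gnsVec φ a‖ ^ 2 : ℝ) : ℂ) = φ (star a * a) := by
  rw [← inner_gnsVec, inner_self_eq_norm_sq_to_K]
  norm_cast

theorem eq_top_of_gnsVec_mem {W : Submodule ℂ φ.GNS} (hW : IsClosed (W : Set φ.GNS))
    (h : ∀ a, gnsVec φ a ∈ W) : W = ⊤ := by
  refine (Submodule.eq_top_iff').2 fun ξ => ?_
  induction ξ using UniformSpace.Completion.induction_on with
  | hp => exact hW
  | ih a => exact h a

end GNS

/-! ### Convergence criteria in Hilbert space -/

section HilbertSums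

variable {H : Type*} [NormedAddCommGroup H]

theorem cauchySeq_of_norm_sub_sq_le {u : ℕ → H} {g : ℕ → ℝ} (hg : CauchySeq g)
    (h : ∀ m n, m ≤ n → ‖u n - u m‖ ^ 2 ≤ |g n - g m|) : CauchySeq u := by
  refine Metric.cauchySeq_iff'.2 fun ε hε => ?_
  obtain ⟨M, hM⟩ := Metric.cauchySeq_iff'.1 hg (ε ^ 2) (by positivity)
  refine ⟨M, fun n hn => ?_⟩
  rw [dist_eq_norm]
  refine lt_of_pow_lt_pow_left₀ 2 hε.le ((h M n hn).trans_lt ?_)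
  have := hM n hn
  rwa [Real.dist_eq] at this

variable [InnerProductSpace ℂ H]

/-- An orthogonal family of vectors exhausting the norm of `Ω` sums to `Ω`. -/
theorem hasSum_of_inner {ι : Type*} {v : ι → H} {Ω : H} {r : ι → ℝ}
    (h0 : ∀ p q, p ≠ q → ⟪v p, v q⟫_ℂ = 0) (h1 : ∀ p, ⟪v p, v p⟫_ℂ = r p)
    (h2 : ∀ p, ⟪Ω, v p⟫_ℂ = r p) (hr : HasSum r (‖Ω‖ ^ 2)) : HasSum v Ω := by
  classical
  -- The hypotheses make each finite partial sum orthogonal to its remainder, so Pythagoras computes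
  -- the error exactly.
  have hnorm (F : Finset ι) : ‖∑ p ∈ F, v p - Ω‖ = √(‖Ω‖ ^ 2 - ∑ p ∈ F, r p) := by
    have e1 : ⟪Ω, ∑ p ∈ F, v p⟫_ℂ = ((∑ p ∈ F, r p : ℝ) : ℂ) := by
      rw [inner_sum, Complex.ofReal_sum]
      exact Finset.sum_congr rfl fun p _ => h2 p
    have e2 : ⟪∑ p ∈ F, v p, ∑ p ∈ F, v p⟫_ℂ = ((∑ p ∈ F, r p : ℝ) : ℂ) := by
      rw [sum_inner, Complex.ofReal_sum]
      refine Finset.sum_congr rfl fun p hp => ?_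
      rw [inner_sum, Finset.sum_eq_single_of_mem p hp fun q _ hq => h0 p q hq.symm, h1]
    have e3 : ‖∑ p ∈ F, v p‖ ^ 2 = ∑ p ∈ F, r p := by
      rw [← inner_self_eq_norm_sq (𝕜 := ℂ), e2]
      simp
    have e4 : ‖Ω - ∑ p ∈ F, v p‖ ^ 2 = ‖Ω‖ ^ 2 - ∑ p ∈ F, r p := by
      rw [@norm_sub_sq ℂ, e1, e3, RCLike.re_eq_complex_re, Complex.ofReal_re]
      ring
    rw [norm_sub_rev, ← e4, Real.sqrt_sq (norm_nonneg _)]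
  rw [HasSum, SummationFilter.unconditional_filter, tendsto_iff_norm_sub_tendsto_zero]
  simp only [hnorm]
  have h3 : Tendsto (fun F : Finset ι => √(‖Ω‖ ^ 2 - ∑ p ∈ F, r p)) atTop
      (𝓝 √(‖Ω‖ ^ 2 - ‖Ω‖ ^ 2)) := (Tendsto.const_sub _ hr).sqrt
  simpa using h3

end HilbertSums

/-! ### Diagonal projections in C*_λ(P) approximating the vacuum -/

section VacuumProjections

variable {G : Type*} [Group G] {P : Submonoid G}

/-- `e` is the diagonal projection onto the span of the `ε_x` with `x ∈ D`. -/
def IsDiagProj (e : EllTwo P →L[ℂ] EllTwo P) (D : Set P) : Prop :=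
  (∀ x ∈ D, e (stdVec x) = stdVec x) ∧ ∀ x ∉ D, e (stdVec x) = 0

theorem IsDiagProj.mul {e f : EllTwo P →L[ℂ] EllTwo P} {D D' : Set P} (he : IsDiagProj e D)
    (hf : IsDiagProj f D') : IsDiagProj (e * f) (D ∩ D') := by
  refine ⟨fun x hx => ?_, fun x hx => ?_⟩
  · rw [mul_apply_eq_comp, hf.1 x hx.2, he.1 x hx.1]
  · rw [mul_apply_eq_comp]
    by_cases h : x ∈ D'
    · rw [hf.1 x h, he.2 x fun h' => hx ⟨h', h⟩]
    · rw [hf.2 x h, map_zero]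

theorem IsDiagProj.eq {e f : EllTwo P →L[ℂ] EllTwo P} {D : Set P} (he : IsDiagProj e D)
    (hf : IsDiagProj f D) : e = f :=
  ext_stdVec fun x => by
    by_cases h : x ∈ D
    · rw [he.1 x h, hf.1 x h]
    · rw [he.2 x h, hf.2 x h]

theorem IsDiagProj.star_eq {e : EllTwo P →L[ℂ] EllTwo P} {D : Set P} (he : IsDiagProj e D) :
    star e = e := by
  classical
  refine ext_stdVec fun x => ?_
  ext y
  rw [← inner_stdVec_left, ← inner_stdVec_left, ContinuousLinearMap.star_eq_adjoint,
    ContinuousLinearMap.adjoint_inner_right]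
  by_cases hx : x ∈ D <;> by_cases hy : y ∈ D
  · rw [he.1 x hx, he.1 y hy]
  · rw [he.1 x hx, he.2 y hy, inner_zero_left, inner_stdVec_left, stdVec_apply, if_neg]
    rintro rfl
    exact hy hx
  · rw [he.2 x hx, he.1 y hy, inner_zero_right, inner_stdVec_left, stdVec_apply, if_neg]
    rintro rfl
    exact hx hy
  · rw [he.2 x hx, he.2 y hy, inner_zero_left, inner_zero_right]

theorem isDiagProj_one_sub (p : P) :
    IsDiagProj (1 - leftTranslation p * star (leftTranslation p)) {x | ∀ y, p * y ≠ x} := by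
  refine ⟨fun x hx => ?_, fun x hx => ?_⟩
  · simp [star_leftTranslation_stdVec_of_forall_ne hx]
  · simp only [Set.mem_ofPred_eq, not_forall, not_not] at hx
    obtain ⟨y, rfl⟩ := hx
    simp [star_leftTranslation_stdVec_mul, leftTranslation_stdVec]

/-- The product of the projections 1 - L_p L_p* over p in F removes every right multiple of every
such p. -/
theorem exists_isDiagProj (F : Finset P) : ∃ e : reducedAlg P,
    IsDiagProj (e : EllTwo P →L[ℂ] EllTwo P) {x | ∀ p ∈ F, ∀ y, p * y ≠ x} := by
  classical
  induction F using Finset.induction_on with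
  | empty => exact ⟨1, fun x _ => rfl, fun x hx => absurd (by simp) hx⟩
  | insert p F _ ih =>
    obtain ⟨e, he⟩ := ih
    refine ⟨(1 - gen p * star (gen p)) * e, ?_⟩
    have h := (isDiagProj_one_sub p).mul he
    rwa [show {x : P | ∀ y, p * y ≠ x} ∩ {x | ∀ q ∈ F, ∀ y, q * y ≠ x} =
      {x | ∀ q ∈ insert p F, ∀ y, q * y ≠ x} by ext x; simp] at h

theorem diagCoeff_of_mem {e : EllTwo P →L[ℂ] EllTwo P} {D : Set P} (he : IsDiagProj e D) {x : P}
    (hx : x ∈ D) : diagCoeff e x = 1 := by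
  rw [diagCoeff, he.1 x hx]
  exact diagCoeff_one x

theorem diagCoeff_of_notMem {e : EllTwo P →L[ℂ] EllTwo P} {D : Set P} (he : IsDiagProj e D) {x : P}
    (hx : x ∉ D) : diagCoeff e x = 0 := by
  rw [diagCoeff, he.2 x hx, inner_zero_right]

variable {N : P →* ℝ} {hN : ∀ p, 1 ≤ N p} {β : ℝ≥0}

/-- Projections in `C*_λ(P)` decreasing to the vacuum projection. -/
theorem exists_vacuum_approximation (hN1 : ∀ p, N p = 1 → p = 1) (hβ : 0 < β)
    (hs : Summable fun p => N p ^ (-(β : ℝ))) : ∃ e : ℕ → reducedAlg P,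
      (∀ n, star (e n) = e n) ∧ (∀ m n, m ≤ n → e m * e n = e n) ∧
      (∀ q, q ≠ 1 → ∀ᶠ n in atTop, star (gen q) * e n = 0) ∧
      Tendsto (fun n => restrictState (gibbsState hN hs) (e n)) atTop
        (𝓝 ((∑' x, N x ^ (-(β : ℝ)) : ℝ) : ℂ)⁻¹) := by
  classical
  -- The projection e n removes the multiples of all p ≠ 1 with N(p) ≤ n. Finiteness of this set
  -- keeps e n in C*_λ(P), and each x ≠ 1, being a multiple of itself, is removed once n ≥ N(x).
  have hfin (n : ℕ) : ({p | N p ≤ n} \ {1}).Finite :=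
    (finite_setOf_le hN (NNReal.coe_pos.2 hβ) hs n).sdiff
  choose e he using fun n => exists_isDiagProj (hfin n).toFinset
  set D : ℕ → Set P := fun n => {x | ∀ p ∈ (hfin n).toFinset, ∀ y, p * y ≠ x} with hD
  have hmemD {n : ℕ} {x : P} : x ∈ D n ↔ ∀ p, N p ≤ n → p ≠ 1 → ∀ y, p * y ≠ x := by
    simp [hD]
  have hanti {m n : ℕ} (hmn : m ≤ n) : D n ⊆ D m := fun x hx => hmemD.2 fun p hp =>
    hmemD.1 hx p (hp.trans (Nat.cast_le.2 hmn))
  have hone (n : ℕ) : 1 ∈ D n := hmemD.2 fun p _ hp1 y hy => hp1 (hN1 p (by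
    have h1 : N p * N y = 1 := by rw [← map_mul, hy, map_one]
    nlinarith [hN p, hN y]))
  refine ⟨e, fun n => Subtype.ext (he n).star_eq, fun m n hmn => Subtype.ext ?_, fun q hq => ?_, ?_⟩
  · have h := (he m).mul (he n)
    rw [Set.inter_eq_right.2 (hanti hmn)] at h
    exact h.eq (he n)
  · filter_upwards [eventually_ge_atTop ⌈N q⌉₊] with n hn
    refine Subtype.ext (ext_stdVec fun x => ?_)
    change star (leftTranslation q) ((e n : EllTwo P →L[ℂ] EllTwo P) (stdVec x)) = 0
    by_cases hx : x ∈ D n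
    · rw [(he n).1 x hx]
      exact star_leftTranslation_stdVec_of_forall_ne (hmemD.1 hx q (Nat.ceil_le.1 hn) hq)
    · rw [(he n).2 x hx, map_zero]
  · have hlim : Tendsto (fun n => ∑' x, ((N x ^ (-(β : ℝ)) : ℝ) : ℂ) *
        diagCoeff (e n : EllTwo P →L[ℂ] EllTwo P) x) atTop
        (𝓝 (∑' x : P, if x = 1 then 1 else 0)) := by
      refine tendsto_tsum_of_dominated_convergence hs (fun x => ?_) ?_
      · refine tendsto_const_nhds.congr' ?_
        filter_upwards [eventually_ge_atTop ⌈N x⌉₊] with n hn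
        split_ifs with hx
        · rw [hx, diagCoeff_of_mem (he n) (hone n), map_one]
          simp
        · rw [diagCoeff_of_notMem (he n) fun h => hmemD.1 h x (Nat.ceil_le.1 hn) hx 1 (mul_one x),
            mul_zero]
      · refine Eventually.of_forall fun n x => ?_
        by_cases hx : x ∈ D n
        · rw [diagCoeff_of_mem (he n) hx, mul_one, Complex.norm_real,
            Real.norm_of_nonneg (rpow_nonneg_of_one_le hN _ x)]
        · rw [diagCoeff_of_notMem (he n) hx, mul_zero, norm_zero]
          exact rpow_nonneg_of_one_le hN _ x
    rw [tsum_ite_eq] at hlim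
    have h := hlim.const_mul ((∑' x, N x ^ (-(β : ℝ)) : ℝ) : ℂ)⁻¹
    rw [mul_one] at h
    refine h.congr fun n => ?_
    rw [← gibbs_eq]
    rfl

end VacuumProjections

/-! ### Vacuum spaces in representations of Nica families -/

section NicaFamilies

/-- A family of isometries `s p`, indexed by a monoid, which satisfies the Nica covariance
relations and generates `A`. -/
structure IsNicaFamily {P A : Type*} [Monoid P] [CStarAlgebra A] (s : P → A) : Prop where
  one : s 1 = 1
  isometry : ∀ p, star (s p) * s p = 1
  nica : ∀ p q, star (s p) * s q = 0 ∨
    ∃ p' q', p * p' = q * q' ∧ star (s p) * s q = s p' * star (s q')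
  generates : ∀ S : Submodule ℂ A, IsClosed (S : Set A) → (∀ p q, s p * star (s q) ∈ S) →
    ∀ a, a ∈ S

theorem IsQuasiLattice.isNicaFamily_gen {G : Type*} [Group G] {P : Submonoid G}
    (hP : IsQuasiLattice P) : IsNicaFamily (gen : P → reducedAlg P) where
  one := gen_one
  isometry := _root_.star_gen_mul_gen
  nica := hP.star_gen_mul_gen
  generates := hP.mem_of_isClosed

variable {P A H : Type*} [Monoid P] [CStarAlgebra A] [NormedAddCommGroup H]
  [InnerProductSpace ℂ H] [CompleteSpace H] {π : A →⋆ₐ[ℂ] (H →L[ℂ] H)} {s : P → A}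

theorem inner_map_star_left (π : A →⋆ₐ[ℂ] (H →L[ℂ] H)) (a : A) (ξ η : H) :
    ⟪π (star a) ξ, η⟫_ℂ = ⟪ξ, π a η⟫_ℂ := by
  rw [map_star, ContinuousLinearMap.star_eq_adjoint, ContinuousLinearMap.adjoint_inner_left]

theorem inner_map_left (π : A →⋆ₐ[ℂ] (H →L[ℂ] H)) (a : A) (ξ η : H) :
    ⟪π a ξ, η⟫_ℂ = ⟪ξ, π (star a) η⟫_ℂ := by
  rw [← inner_map_star_left, star_star]

theorem map_mul_apply' (π : A →⋆ₐ[ℂ] (H →L[ℂ] H)) (a b : A) (ξ : H) :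
    π (a * b) ξ = π a (π b ξ) := by
  rw [map_mul, mul_apply_eq_comp]

/-- The vectors annihilated by all `π(s_p)*` with `p ≠ 1`. -/
def vacuumSpace (π : A →⋆ₐ[ℂ] (H →L[ℂ] H)) (s : P → A) : Submodule ℂ H :=
  ⨅ p : {p : P // p ≠ 1}, LinearMap.ker (π (star (s p))).toLinearMap

theorem mem_vacuumSpace_iff {ξ : H} :
    ξ ∈ vacuumSpace π s ↔ ∀ p, p ≠ 1 → π (star (s p)) ξ = 0 := by
  simp [vacuumSpace]

theorem isClosed_vacuumSpace : IsClosed (vacuumSpace π s : Set H) := by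
  rw [vacuumSpace, Submodule.coe_iInf]
  exact isClosed_iInter fun p => (π (star (s p))).isClosed_ker

instance : CompleteSpace (vacuumSpace π s) := isClosed_vacuumSpace.completeSpace_coe

/-- If q ≠ 1 the right letter kills η; otherwise p ≠ 1, and the left letter, moved across the inner
product, kills ξ. -/
theorem inner_map_mul_star_of_mem_vacuumSpace {p q : P} (h : ¬(p = 1 ∧ q = 1))
    {ξ η : H} (hξ : ξ ∈ vacuumSpace π s) (hη : η ∈ vacuumSpace π s) :
    ⟪ξ, π (s p * star (s q)) η⟫_ℂ = 0 := by
  rw [map_mul_apply']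
  by_cases hq : q = 1
  · rw [← inner_map_star_left, mem_vacuumSpace_iff.1 hξ p fun hp => h ⟨hp, hq⟩, inner_zero_left]
  · rw [mem_vacuumSpace_iff.1 hη q hq, map_zero, inner_zero_right]

theorem apply_mem_vacuumSpace {y : H →L[ℂ] H} (hy : ∀ a, π a * y = y * π a) {ξ : H}
    (hξ : ξ ∈ vacuumSpace π s) : y ξ ∈ vacuumSpace π s := by
  refine mem_vacuumSpace_iff.2 fun p hp => ?_
  rw [← mul_apply_eq_comp, hy, mul_apply_eq_comp, mem_vacuumSpace_iff.1 hξ p hp, map_zero]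

/-- Both sides are continuous and linear in a, so words suffice: nontrivial ones vanish on both
sides and the identity acts as 1. The scalar is read off from one fixed unit vector, hence does not
depend on ξ. -/
theorem IsNicaFamily.compression_vacuumSpace (hs : IsNicaFamily s) {ξ₀ : H}
    (hξ₀ : ξ₀ ∈ vacuumSpace π s) (hnorm : ‖ξ₀‖ = 1) (a : A) {ξ : H}
    (hξ : ξ ∈ vacuumSpace π s) : (vacuumSpace π s).starProjection (π a ξ) =
      ⟪ξ₀, π a ξ₀⟫_ℂ • ξ := by
  have hcont : Continuous fun a => π a := AddMonoidHomClass.continuous_of_bound π 1 fun a => by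
    simpa using NonUnitalStarAlgHom.norm_apply_le π a
  let f : A →ₗ[ℂ] H :=
    { toFun := fun a => (vacuumSpace π s).starProjection (π a ξ)
      map_add' := fun a b => by rw [map_add, add_apply, map_add]
      map_smul' := fun c a => by rw [map_smul, smul_apply, map_smul, RingHom.id_apply] }
  let g : A →ₗ[ℂ] H :=
    { toFun := fun a => ⟪ξ₀, π a ξ₀⟫_ℂ • ξ
      map_add' := fun a b => by rw [map_add, add_apply, inner_add_right, add_smul]
      map_smul' := fun c a => by
        rw [map_smul, smul_apply, inner_smul_right, RingHom.id_apply, mul_smul] }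
  refine hs.generates (LinearMap.eqLocus f g) (isClosed_eq ?_ ?_) (fun p q => ?_) a
  · exact (vacuumSpace π s).starProjection.continuous.comp (hcont.clm_apply continuous_const)
  · exact (continuous_const.inner (hcont.clm_apply continuous_const)).smul continuous_const
  change (vacuumSpace π s).starProjection (π (s p * star (s q)) ξ) =
    ⟪ξ₀, π (s p * star (s q)) ξ₀⟫_ℂ • ξ
  by_cases h : p = 1 ∧ q = 1
  · rw [h.1, h.2, hs.one, star_one, one_mul, map_one, one_apply_eq_self,
      one_apply_eq_self, Submodule.starProjection_eq_self_iff.2 hξ,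
      inner_self_eq_norm_sq_to_K, hnorm]
    simp
  · rw [inner_map_mul_star_of_mem_vacuumSpace h hξ₀ hξ₀, zero_smul,
      Submodule.starProjection_apply_eq_zero_iff, Submodule.mem_orthogonal]
    exact fun η hη => inner_map_mul_star_of_mem_vacuumSpace h hη hξ

section Vectors

variable {Ω : H} {φ : A → ℂ} {r : P → ℝ} {e : ℕ → A}

/-- For decreasing projections `e n`, the vectors `π(e_n t*) Ω` converge if the vector state of `Ω`
is scaled by `t`. -/
theorem exists_tendsto_apply_star (hφ : ∀ a, ⟪Ω, π a Ω⟫_ℂ = φ a)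
    {t : A} {c : ℝ} (hK : ∀ b, φ (t * b * star t) = c * φ b)
    (hstar : ∀ n, star (e n) = e n) (hmul : ∀ m n, m ≤ n → e m * e n = e n) {z : ℂ}
    (hlim : Tendsto (fun n => φ (e n)) atTop (𝓝 z)) :
    ∃ ω, Tendsto (fun n => π (e n * star t) Ω) atTop (𝓝 ω) := by
  -- For m ≤ n, e m - e n is a projection, so the squared distance of the two vectors is exactly
  -- c(φ(e m) - φ(e n)), and φ(e n) converges.
  refine cauchySeq_tendsto_of_complete (cauchySeq_of_norm_sub_sq_le
    (g := fun n => c * (φ (e n)).re) ?_ fun m n hmn => ?_)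
  · exact (((Complex.continuous_re.tendsto z).comp hlim).const_mul _).cauchySeq
  · have hmul' : e n * e m = e n := by
      have h := congrArg star (hmul m n hmn)
      rwa [star_mul, hstar, hstar] at h
    have h2 : (e n - e m) * (e n - e m) = e m - e n := by
      rw [_root_.sub_mul, _root_.mul_sub, _root_.mul_sub, hmul m n hmn, hmul', hmul n n le_rfl,
        hmul m m le_rfl]
      abel
    have h1 : star (e n * star t - e m * star t) *
        (e n * star t - e m * star t) = t * (e m - e n) * star t := by
      rw [← _root_.sub_mul, star_mul, star_star, star_sub, hstar, hstar, ← h2]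
      noncomm_ring
    have h3 : φ (e m - e n) = φ (e m) - φ (e n) := by
      rw [← hφ, ← hφ, ← hφ, map_sub, sub_apply, inner_sub_right]
    rw [← sub_apply, ← map_sub, ← inner_self_eq_norm_sq (𝕜 := ℂ), inner_map_left, ← map_mul_apply',
      h1, hφ, hK, h3, RCLike.re_eq_complex_re, Complex.re_ofReal_mul, Complex.sub_re, abs_sub_comm,
      ← _root_.mul_sub]
    exact le_abs_self _

/-- A cyclic vector whose vector state scales as a Gibbs state decomposes along the translates of
the vacuum space. -/
theorem IsNicaFamily.exists_hasSum_vacuum (hs : IsNicaFamily s) (hφ : ∀ a, ⟪Ω, π a Ω⟫_ℂ = φ a)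
    (hφ1 : φ 1 = 1) (hK : ∀ p b, φ (s p * b * star (s p)) = r p * φ b)
    (hstar : ∀ n, star (e n) = e n) (hmul : ∀ m n, m ≤ n → e m * e n = e n)
    (hgen : ∀ q, q ≠ 1 → ∀ᶠ n in atTop, star (s q) * e n = 0)
    (hr : Summable r) (hZ : ∑' p, r p ≠ 0)
    (hlim : Tendsto (fun n => φ (e n)) atTop (𝓝 ((∑' x, r x : ℝ) : ℂ)⁻¹)) :
    ∃ ω : P → H, (∀ p, ω p ∈ vacuumSpace π s) ∧ HasSum (fun p => π (s p) (ω p)) Ω := by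
  -- Here ω p is the limit of π(e_n s_p*)Ω, so π(s_p)(ω p) plays the role of the component of Ω
  -- under the projection s_p Q s_p*, with Q the limit of the e_n.
  choose ω hω using fun p => exists_tendsto_apply_star hφ (hK p) hstar hmul hlim
  have hmem (p : P) : ω p ∈ vacuumSpace π s := mem_vacuumSpace_iff.2 fun q hq => by
    refine tendsto_nhds_unique (((π (star (s q))).continuous.tendsto _).comp
      (hω p)) (tendsto_const_nhds.congr' ?_)
    filter_upwards [hgen q hq] with n hn
    rw [Function.comp_apply, ← map_mul_apply', ← mul_assoc, hn, zero_mul, map_zero, zero_apply]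
  have hr' (p : P) : Tendsto (fun n => φ (s p * e n * star (s p))) atTop
      (𝓝 ((r p * (∑' x, r x)⁻¹ : ℝ) : ℂ)) := by
    simp only [hK]
    rw [Complex.ofReal_mul, Complex.ofReal_inv]
    exact hlim.const_mul _
  have hself (p : P) : ⟪π (s p) (ω p), π (s p) (ω p)⟫_ℂ =
      ((r p * (∑' x, r x)⁻¹ : ℝ) : ℂ) := by
    rw [inner_map_left, ← map_mul_apply', hs.isometry, map_one, one_apply_eq_self]
    refine tendsto_nhds_unique ((hω p).inner (hω p)) ((hr' p).congr fun n => ?_)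
    rw [inner_map_left, ← map_mul_apply', hφ, star_mul, star_star, hstar]
    congr 1
    rw [mul_assoc (s p) (e n) (e n * _), ← mul_assoc (e n), hmul n n le_rfl, ← mul_assoc]
  refine ⟨ω, hmem, hasSum_of_inner (fun p q hpq => ?_) hself (fun p => ?_) ?_⟩
  · rw [inner_map_left, ← map_mul_apply']
    rcases hs.nica p q with h | ⟨p', q', h1, h⟩
    · rw [h, map_zero, zero_apply, inner_zero_right]
    · rw [h]
      refine inner_map_mul_star_of_mem_vacuumSpace ?_ (hmem p) (hmem q)
      -- If both cofactors were 1, the common multiple would force p = q.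
      rintro ⟨rfl, rfl⟩
      rw [mul_one, mul_one] at h1
      exact hpq h1
  · refine tendsto_nhds_unique (Tendsto.inner tendsto_const_nhds
      (((π (s p)).continuous.tendsto _).comp (hω p))) ((hr' p).congr fun n => ?_)
    rw [Function.comp_apply, ← map_mul_apply', hφ, ← mul_assoc]
  · have h1 : ‖Ω‖ ^ 2 = 1 := by
      have h := congrArg Complex.re (hφ 1)
      rwa [map_one, one_apply_eq_self, hφ1, Complex.one_re, ← RCLike.re_eq_complex_re,
        inner_self_eq_norm_sq] at h
    -- The squared norms r p / ∑ r add up to 1 = ‖Ω‖², so the components exhaust Ω.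
    have h := hr.hasSum.mul_right (∑' x, r x)⁻¹
    rwa [mul_inv_cancel₀ hZ, ← h1] at h

/-- A closed subspace containing π(A) times the vacuum space contains each π(a)Ω, by the
decomposition of Ω, and so is everything by cyclicity. The vacuum space is nonzero because otherwise
Ω would be 0. -/
theorem IsNicaFamily.isTypeIInftyFactor (hs : IsNicaFamily s) (hΩ : Ω ≠ 0) {ω : P → H}
    (hω : ∀ p, ω p ∈ vacuumSpace π s) (hsum : HasSum (fun p => π (s p) (ω p)) Ω)
    (hcyc : ∀ W : Submodule ℂ H, IsClosed (W : Set H) → (∀ a, π a Ω ∈ W) → W = ⊤)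
    {q : P} (hq : π (s q * star (s q)) ≠ 1) : IsTypeIInftyFactor (generatedVN π) := by
  have hvec (W : Submodule ℂ H) (hW : IsClosed (W : Set H))
      (h : ∀ a, ∀ ξ ∈ vacuumSpace π s, π a ξ ∈ W) (a : A) : π a Ω ∈ W := by
    refine hW.mem_of_tendsto (hsum.mapL (π a)) (Eventually.of_forall fun F =>
      W.sum_mem fun p _ => ?_)
    rw [← map_mul_apply']
    exact h _ _ (hω p)
  have hbot : vacuumSpace π s ≠ ⊥ := by
    intro h0
    refine hΩ (hsum.unique ?_)
    have h1 (p : P) : π (s p) (ω p) = 0 := by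
      have h2 := hω p
      rw [h0, Submodule.mem_bot] at h2
      rw [h2, map_zero]
    simp only [h1]
    exact hasSum_zero
  obtain ⟨ξ, hξ, hξ0⟩ := Submodule.exists_mem_ne_zero_of_ne_bot hbot
  have hξ' : ((‖ξ‖⁻¹ : ℝ) : ℂ) • ξ ∈ vacuumSpace π s := (vacuumSpace π s).smul_mem _ hξ
  have hnorm : ‖((‖ξ‖⁻¹ : ℝ) : ℂ) • ξ‖ = 1 := by
    rw [norm_smul, Complex.norm_real, norm_inv, norm_norm, inv_mul_cancel₀ (norm_ne_zero_iff.2 hξ0)]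
  exact isTypeIInftyFactor_of_subspace (S := vacuumSpace π s)
    (fun y hy ξ hξ => apply_mem_vacuumSpace hy hξ) hbot
    (fun a => ⟨_, fun η hη => hs.compression_vacuumSpace hξ' hnorm a hη⟩)
    (fun W hW h => hcyc W hW (hvec W hW h)) (hs.isometry q) hq

end Vectors

end NicaFamilies

/-! ### Faithfulness and type of the Gibbs representation -/

section GibbsRepresentation

variable {G : Type*} [Group G] {P : Submonoid G} {N : P →* ℝ} {hN : ∀ p, 1 ≤ N p} {β : ℝ≥0}

theorem diagCoeff_star_mul_self (X : EllTwo P →L[ℂ] EllTwo P) (x : P) :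
    diagCoeff (star X * X) x = ((‖X (stdVec x)‖ ^ 2 : ℝ) : ℂ) := by
  rw [diagCoeff, mul_apply_eq_comp, ContinuousLinearMap.star_eq_adjoint,
    ContinuousLinearMap.adjoint_inner_right, inner_self_eq_norm_sq_to_K]
  norm_cast

/-- The Gibbs state is faithful on `B(ℓ²(P))`. -/
theorem eq_zero_of_gibbs_star_mul_self (hN : ∀ p, 1 ≤ N p)
    (hs : Summable fun p => N p ^ (-(β : ℝ)))
    {X : EllTwo P →L[ℂ] EllTwo P} (h : gibbs N hN β (star X * X) = 0) : X = 0 := by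
  have hZ := opTrace_expNegH_ne_zero (hN := hN) hs
  have hsum := summable_rpow_mul_diagCoeff hN hs (star X * X)
  rw [gibbs, opTrace_mul_expNegH] at h
  have h0 := (mul_eq_zero.1 h).resolve_left (inv_ne_zero hZ)
  simp only [diagCoeff_star_mul_self, ← Complex.ofReal_mul] at h0 hsum
  rw [← Complex.ofReal_tsum, Complex.ofReal_eq_zero] at h0
  have hsum' := Complex.summable_ofReal.1 hsum
  have hnonneg (x : P) : 0 ≤ N x ^ (-(β : ℝ)) * ‖X (stdVec x)‖ ^ 2 :=
    mul_nonneg (rpow_nonneg_of_one_le hN _ x) (sq_nonneg _)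
  have h1 := (hasSum_zero_iff_of_nonneg hnonneg).1 (h0 ▸ hsum'.hasSum)
  refine ext_stdVec fun x => ?_
  have h2 := (mul_eq_zero.1 (congrFun h1 x)).resolve_left
    (Real.rpow_pos_of_pos (zero_lt_one.trans_le (hN x)) _).ne'
  rw [zero_apply]
  exact norm_eq_zero.1 (pow_eq_zero_iff two_ne_zero |>.1 h2)

/-- If π(a) = 0 then applying it to the cyclic vector gives φ(a*a) = 0. -/
theorem gnsStarAlgHom_injective {A : Type*} [CStarAlgebra A] [PartialOrder A] [StarOrderedRing A]
    {φ : A →ₚ[ℂ] ℂ} (h : ∀ a, φ (star a * a) = 0 → a = 0) :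
    Function.Injective φ.gnsStarAlgHom := by
  refine (injective_iff_map_eq_zero _).2 fun a ha => h a ?_
  have h1 := gnsStarAlgHom_gnsVec (φ := φ) a 1
  rw [ha, mul_one, zero_apply] at h1
  rw [← norm_gnsVec_sq, ← h1]
  simp

/-- The GNS representation is faithful and generates a factor of type `I_∞`. -/
def IsFaithfulTypeIInfty {A : Type*} [CStarAlgebra A] [PartialOrder A] [StarOrderedRing A]
    (φ : A →ₚ[ℂ] ℂ) : Prop :=
  Function.Injective φ.gnsStarAlgHom ∧ IsTypeIInftyFactor (generatedVN φ.gnsStarAlgHom)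

theorem IsNicaFamily.isFaithfulTypeIInfty {A Q : Type*} [CStarAlgebra A] [PartialOrder A]
    [StarOrderedRing A] [Monoid Q] {φ : A →ₚ[ℂ] ℂ} {s : Q → A} {r : Q → ℝ} {e : ℕ → A} (hs : IsNicaFamily s)
    (hφ : IsState φ) (hK : ∀ p b, φ (s p * b * star (s p)) = r p * φ b)
    (hstar : ∀ n, star (e n) = e n) (hmul : ∀ m n, m ≤ n → e m * e n = e n)
    (hgen : ∀ q, q ≠ 1 → ∀ᶠ n in atTop, star (s q) * e n = 0)
    (hr : Summable r) (hZ : ∑' p, r p ≠ 0)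
    (hlim : Tendsto (fun n => φ (e n)) atTop (𝓝 ((∑' x, r x : ℝ) : ℂ)⁻¹))
    (hfaithful : ∀ a, φ (star a * a) = 0 → a = 0) {q : Q} (hq : s q * star (s q) ≠ 1) :
    IsFaithfulTypeIInfty φ := by
  have hinj := gnsStarAlgHom_injective hfaithful
  have hvec (a : A) : φ.gnsStarAlgHom a (gnsVec φ 1) = gnsVec φ a := by
    rw [gnsStarAlgHom_gnsVec, mul_one]
  have hφ' (a : A) : ⟪gnsVec φ 1, φ.gnsStarAlgHom a (gnsVec φ 1)⟫_ℂ = φ a := by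
    rw [hvec, inner_gnsVec, star_one, one_mul]
  obtain ⟨ω, hω, hsum⟩ := hs.exists_hasSum_vacuum hφ' hφ hK hstar hmul hgen hr hZ hlim
  refine ⟨hinj, ?_⟩
  refine hs.isTypeIInftyFactor (fun h0 => ?_) hω hsum (fun W hW h => ?_)
    (fun h => hq (hinj (h.trans (map_one _).symm)))
  · have h1 := hφ' 1
    rw [h0, inner_zero_left, hφ] at h1
    exact zero_ne_one h1
  · exact eq_top_of_gnsVec_mem hW fun a => hvec a ▸ h a

theorem gen_mul_star_gen_ne_one {q : P} (hq : ∀ x, q * x ≠ 1) : gen q * star (gen q) ≠ 1 := by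
  intro h
  have h3 : leftTranslation q (star (leftTranslation q) (stdVec 1)) = stdVec 1 :=
    congrArg (fun a : reducedAlg P => (a : EllTwo P →L[ℂ] EllTwo P) (stdVec 1)) h
  rw [star_leftTranslation_stdVec_of_forall_ne hq, map_zero] at h3
  have h4 := norm_stdVec (1 : P)
  rw [← h3, norm_zero] at h4
  exact zero_ne_one h4

theorem isFaithfulTypeIInfty_gibbsState (hP : IsQuasiLattice P)
    (hN1 : ∀ p, N p = 1 → p = 1) (hβ : 0 < β) (hs : Summable fun p => N p ^ (-(β : ℝ)))
    (hne : ∃ q : P, q ≠ 1) :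
    IsFaithfulTypeIInfty (restrictState (gibbsState hN hs)) := by
  obtain ⟨q, hq⟩ := hne
  obtain ⟨e, hstar, hmul, hgen, hlim⟩ := exists_vacuum_approximation (hN := hN) hN1 hβ hs
  refine hP.isNicaFamily_gen.isFaithfulTypeIInfty
    (isState_restrictState (isState_gibbsState hs)) (fun p b => ?_) hstar hmul hgen hs
    (zero_lt_one.trans_le (one_le_tsum_rpow hN hs)).ne' hlim
    (fun _ ha => Subtype.ext (eq_zero_of_gibbs_star_mul_self hN hs ha))
    (gen_mul_star_gen_ne_one (q := q) fun x hx => hq (hN1 q ?_))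
  · rw [mul_assoc, restrictState_gibbsState_gen_mul, mul_assoc, star_gen_mul_gen, mul_one]
  · have h1 : N q * N x = 1 := by rw [← map_mul, hx, map_one]
    nlinarith [hN q, hN x]

/-- For trivial P the trace is finite at every positive β, which makes β_c = 0. A nontrivial element
is needed to produce a proper isometry. -/
theorem exists_ne_one_of_betaCrit_pos (h : 0 < betaCrit N hN) : ∃ q : P, q ≠ 1 := by
  by_contra! hall
  have : Subsingleton P := ⟨fun x y => (hall x).trans (hall y).symm⟩
  refine h.ne' (le_antisymm (ENNReal.le_of_forall_pos_le_add fun ε hε _ => ?_) zero_le)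
  rw [zero_add]
  exact sInf_le ⟨ε, ⟨hε, (posTrace_lt_top_iff hN ε).2 (Summable.of_finite)⟩, rfl⟩

end GibbsRepresentation

end

/-! ### Assembly of the theorem -/

theorem mainTheorem1 {G : Type*} [Group G] (P : Submonoid G) (hP : IsQuasiLattice P)
    (N : P →* ℝ) (hN : ∀ p, 1 ≤ N p) (hN1 : ∀ p, N p = 1 → p = 1) :
    (0 < betaCrit N hN → betaCrit N hN < ∞ →
      (∀ β : ℝ≥0, betaCrit N hN < β →
        ∃ ψ : (EllTwo P →L[ℂ] EllTwo P) →ₚ[ℂ] ℂ,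
          IsState ψ ∧ (∀ X, ψ X = gibbs N hN β X) ∧
          IsKMS (dynamics N hN) β (restrictState ψ) ∧
          (∀ φ, IsKMS (dynamics N hN) β φ → φ = restrictState ψ) ∧
          Function.Injective (restrictState ψ).gnsStarAlgHom ∧
          IsTypeIInftyFactor (generatedVN (restrictState ψ).gnsStarAlgHom) ∧
          posTrace (expNegH N hN β) < ∞ ∧
          opTrace (expNegH N hN β) * ψ (vacuumProj P) = 1) ∧
      ∃! φ, IsKMS (dynamics N hN) (betaCrit N hN).toReal φ) ∧
    IsGroundState (dynamics N hN) fockState ∧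
    (∀ φ, IsGroundState (dynamics N hN) φ → φ = fockState) ∧
    (betaCrit N hN < ∞ → IsKMSInfty (dynamics N hN) fockState) := by
  refine ⟨fun h0 hcrit => ⟨fun β hβ => ?_, ?_⟩, isGroundState_fockState,
    fun φ hφ => hφ.eq hP hN1 isGroundState_fockState, isKMSInfty_fockState hN1⟩
  · have hpos : 0 < β := ENNReal.coe_pos.1 (h0.trans hβ)
    have hs := summable_of_betaCrit_lt hβ
    have hne := exists_ne_one_of_betaCrit_pos h0
    have hT := isFaithfulTypeIInfty_gibbsState (hN := hN) hP hN1 hpos hs hne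
    have hK := isKMS_gibbsState (hN := hN) hpos hs
    refine ⟨gibbsState hN hs, ?_, ?_, ?_, fun φ hφ => ?_, ?_, ?_, ?_, ?_⟩
    · exact isState_gibbsState hs
    · exact gibbsState_apply hs
    · exact hK
    · exact IsKMS.eq hP hN1 (NNReal.coe_pos.2 hpos) hcrit hφ hK
    · exact hT.1
    · exact hT.2
    · exact (posTrace_lt_top_iff hN β).2 hs
    · rw [gibbsState_apply]
      exact opTrace_expNegH_mul_gibbs_vacuumProj hs
  · obtain ⟨φ, hφ⟩ := exists_isKMS_betaCrit h0 hcrit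
    exact ⟨φ, hφ, fun ψ hψ =>
      IsKMS.eq hP hN1 (ENNReal.toReal_pos h0.ne' hcrit.ne) hcrit hψ hφ⟩
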